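/- Let $k>0$, $j\in\{1,2\}$, and let $u_0,\sigma_0,u_b,\sigma_b,c$ be real constants with $$\sigma_0+(-1)^jk\,u_0=c,\qquad \sigma_b+(-1)^jk\,u_b=c,$$ i.e. both data lie on the same level set of the $j$-th Riemann invariant $\sigma+(-1)^jku$ of the system $$u_t+uu_x-\sigma_x=0,\qquad \sigma_t+u\sigma_x-k^2u_x=0\qquad(x>0,\ t>0). \tag{1}$$ Put $\alpha=(-1)^{j+1}k$, $\bar u_0=u_0-\alpha$, $\bar u_b=u_b-\alpha$. For $\varepsilon>0$ let $w^\varepsilon$ be the classical solution (continuous on $x,t\ge 0$, $C^2$ in $x,t>0$, with a one-sided $x$-derivative at $x=0$ for $t>0$, and of at most exponential growth in $x$ on each strip $0\le t\le T$) of $$w_t=\varepsilon w_{xx}\ (x,t>0),\qquad w(x,0)=e^{-\bar u_0x/(2\varepsilon)}\ (x\ge0),\qquad 2\varepsilon w_x(0,t)+\bar u_b\,w(0,t)=0\ (t>0),$$ and set $$u^\varepsilon=-2\varepsilon\,\frac{w^\varepsilon_x}{w^\varepsilon}+\alpha,\qquad \sigma^\varepsilon=\alpha u^\varepsilon+c .$$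 **Theorem 4.1.** For every $\varepsilon>0$ such a $w^\varepsilon$ exists, and every such $w^\varepsilon$ is strictly positive on $x,t\ge 0$. There are functions $u,\sigma$, independent of the choice of the $w^\varepsilon$, such that, as $\varepsilon\to0^+$, $u^\varepsilon\to u$ pointwise almost everywhere in $\{x>0,t>0\}$ and $\sigma^\varepsilon\to\sigma$ in the sense of distributions on $\{x>0,t>0\}$. Moreover $\sigma=\alpha u+c$, and for all $x,t>0$ (off the rays separating the regions): 1. if $\bar u_0=\bar u_b>0$, then $u=u_0$; 2. if $\bar u_0=\bar u_b<0$, then $u=u_0$; 3. if $0<\bar u_b<\bar u_0$, then $u=u_b$ for $x<\bar u_bt$, $u=x/t+\alpha$ for $\bar u_bt<x<\bar u_0t$, and $u=u_0$ for $x>\bar u_0t$; 4. if $\bar u_b<0<\bar u_0$, then $u=x/t+\alpha$ for $0<x<\bar u_0t$, and $u=u_0$ for $x>\bar u_0t$; 5. if $\bar u_b<0$ and $\bar u_0\le0$, then $u=u_0$; 6. if $\bar u_0<\bar u_b$ and $\bar u_0+\bar u_b>0$, then $u=u_b$ for $x<st$ and $u=u_0$ for $x>st$, where $s=(\bar u_0+\bar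 u_b)/2$. The limit $(u,\sigma)$ is bounded and is a weak solution of (1): for every $\varphi\in C_c^\infty(\{x>0,t>0\})$, $$\iint \Big(u\varphi_t+\big(\tfrac{u^2}{2}-\sigma\big)\varphi_x\Big)\,dx\,dt=0,\qquad \iint\Big(\sigma\varphi_t+\big(\alpha\tfrac{u^2}{2}-k^2u\big)\varphi_x\Big)\,dx\,dt=0,$$ where the nonconservative product $u\sigma_x$ is read as $\alpha(u^2/2)_x$, since $\sigma=\alpha u+c$. It takes the initial values: $u(x,t)\to u_0$ and $\sigma(x,t)\to\sigma_0$ as $t\to0^+$, for every $x>0$. -/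

import Mathlib

open Set Filter Topology MeasureTheory
open scoped ContDiff

/-- The open quarter plane `x > 0`, `t > 0`; points are pairs `(x, t)`. -/
def quarterPlane : Set (ℝ × ℝ) := Ioi 0 ×ˢ Ioi 0

/-- Test functions: smooth functions with compact support in the open quarter plane. -/
structure IsTestFunction (φ : ℝ × ℝ → ℝ) : Prop where
  smooth : ContDiff ℝ ∞ φ
  compact : HasCompactSupport φ
  support : tsupport φ ⊆ quarterPlane

/-- The signed speed `(-1)^(j+1) k`. -/
noncomputable def signedSpeed (k : ℝ) (j : ℕ) : ℝ := (-1) ^ (j + 1) * k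

/-- `w` is a classical solution of the linear problem obtained by the Hopf-Cole transformation
`v = -2 ε (log w)_x` from Burgers' equation `v_t + v v_x = ε v_xx` with constant initial value `v0`
and constant boundary value `vb`:
`w_t = ε w_xx` for `x, t > 0`, `w(x,0) = exp(-v0 x / (2ε))`, `2 ε w_x(0,t) + vb w(0,t) = 0`.
The function is continuous up to the boundary, and it has at most exponential growth in `x` on
every time strip (the class in which the problem is well posed). -/
structure IsHopfColeSolution (ε v0 vb : ℝ) (w : ℝ → ℝ → ℝ) : Prop where
  continuousOn : ContinuousOn (fun p : ℝ × ℝ => w p.1 p.2) (Ici 0 ×ˢ Ici 0)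
  contDiffOn : ContDiffOn ℝ 2 (fun p : ℝ × ℝ => w p.1 p.2) quarterPlane
  heat : ∀ x > 0, ∀ t > 0,
    deriv (fun s => w x s) t = ε * deriv (deriv (fun y => w y t)) x
  initial : ∀ x ≥ 0, w x 0 = Real.exp (-(v0 * x) / (2 * ε))
  boundary : ∀ t > 0, ∃ d : ℝ,
    HasDerivWithinAt (fun x => w x t) d (Ici 0) 0 ∧ 2 * ε * d + vb * w 0 t = 0
  growth : ∀ T > 0, ∃ C a : ℝ, ∀ x ≥ 0, ∀ t ∈ Icc 0 T, |w x t| ≤ C * Real.exp (a * x)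

/-- The viscous velocity `u^ε = -2 ε w_x / w + (-1)^(j+1) k`. -/
noncomputable def viscousU (k : ℝ) (j : ℕ) (ε : ℝ) (w : ℝ → ℝ → ℝ) (x t : ℝ) : ℝ :=
  -2 * ε * (deriv (fun y => w y t) x / w x t) + signedSpeed k j

/-- The viscous stress `σ^ε = (-1)^(j+1) k u^ε + c`. -/
noncomputable def viscousSigma (k : ℝ) (j : ℕ) (c ε : ℝ) (w : ℝ → ℝ → ℝ) (x t : ℝ) : ℝ :=
  signedSpeed k j * viscousU k j ε w x t + c

/-- Bounded weak solutions, lying on the level set `σ + (-1)^j k u = c`, of the system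
`u_t + u u_x - σ_x = 0`, `σ_t + u σ_x - k^2 u_x = 0` in the open quarter plane.
On this level set `σ = α u + c` with `α = (-1)^(j+1) k`, and the products are
`u u_x = (u^2/2)_x` and `u σ_x = α (u^2/2)_x` in the sense of distributions. -/
structure IsWeakSolutionOnLevelSet (k : ℝ) (j : ℕ) (c : ℝ) (u σ : ℝ → ℝ → ℝ) : Prop where
  bounded : MemLp (fun p : ℝ × ℝ => u p.1 p.2) ⊤ (volume.restrict quarterPlane)
  level : ∀ᵐ p ∂(volume.restrict quarterPlane),
    σ p.1 p.2 + (-1) ^ j * k * u p.1 p.2 = c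
  velocity : ∀ φ : ℝ × ℝ → ℝ, IsTestFunction φ →
    ∫ p in quarterPlane,
      (u p.1 p.2 * fderiv ℝ φ p (0, 1)
        + (u p.1 p.2 ^ 2 / 2 - σ p.1 p.2) * fderiv ℝ φ p (1, 0)) = 0
  stress : ∀ φ : ℝ × ℝ → ℝ, IsTestFunction φ →
    ∫ p in quarterPlane,
      (σ p.1 p.2 * fderiv ℝ φ p (0, 1)
        + (signedSpeed k j * (u p.1 p.2 ^ 2 / 2) - k ^ 2 * u p.1 p.2)
          * fderiv ℝ φ p (1, 0)) = 0

/-! ### The Gaussian distribution function and the Mills function -/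

/-! On the level set `σ = α u + c` both equations reduce to Burgers' equation for `v = u - α`, with
initial value `a = v₀` and boundary datum `b = v_b`. Hopf-Cole makes the viscous problem a heat
equation with a Robin condition, which is solved in closed form.

Write `Φ` for `gaussCdf`, `M(r) = exp (r²) Φ(r)` for `mills`, and put `τ = 1/√(4εt)`. For solutions
`w`, the quantity `z = w_x + l w` with `l = b/(2ε)` vanishes at `x = 0`, so it is given by odd
reflection, and integrating back yields `w`. A comparison argument with an exponential barrier shows
that this is the only solution of exponential growth. After division by `exp (-x²τ²)` the viscous
velocity is `b + (a - b)(P - Q)/D`, where `P = M((x - at)τ)`, `Q = M((-x - at)τ)`, `R = M((bt -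
x)τ)` and `D = P + R + (b - a)(R - Q)/(a + b)`, the quotient being a derivative when `a + b = 0`.

The first three derivatives of `M` are positive. Monotonicity of `M` gives `P - Q ≥ 0`, and
positivity of `M'` and `M''` gives `P - Q < D`. Hence `w > 0`, and the velocity is bounded uniformly
in `ε`. Positivity up to `M'''` also gives the algebraic decay of `M` and `M'` at `-∞`. As `ε → 0`,
`τ → ∞`: a term with positive argument grows like a Gaussian exponential, one with negative argument
decays like `1/τ`. Comparing arguments decides the limit: `P` dominant gives `a`, `R` dominant gives
`b`, and if all arguments are negative the `1/τ` coefficients give `x/t`. Only three rays are left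
out. Dominated convergence handles `σ`.

The limit `U` is a weak solution because it selects, at each point, the extremal line among `v x -
v² t/2`: the maximum over `v ∈ [b, a]` if `b ≤ a`, the minimum over `{a, b}` if `a < b`. The
envelope `S` is Lipschitz with `S_x = U` and `S_t = -U²/2` almost everywhere, and equality of mixed
derivatives is Burgers' equation. The main carriers are `le_of_isHopfColeSolution`,
`sub_lt_robinProfile`, `tendsto_burgersProfile` and `burgers_weak_of_envelope`. -/

/-- The distribution function of the Gaussian density `exp (-y²) / √π`. -/
noncomputable def gaussCdf (z : ℝ) : ℝ :=
  1 / 2 + (√Real.pi)⁻¹ * ∫ y in (0 : ℝ)..z, Real.exp (-y ^ 2)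

theorem sqrt_pi_pos : 0 < √Real.pi := Real.sqrt_pos.2 Real.pi_pos

theorem gaussCdf_zero : gaussCdf 0 = 1 / 2 := by simp [gaussCdf]

theorem hasDerivAt_gaussCdf (z : ℝ) :
    HasDerivAt gaussCdf ((√Real.pi)⁻¹ * Real.exp (-z ^ 2)) z := by
  have hc : Continuous fun y : ℝ => Real.exp (-y ^ 2) := by fun_prop
  have h := intervalIntegral.integral_hasDerivAt_right (hc.intervalIntegrable 0 z)
    hc.aestronglyMeasurable.stronglyMeasurableAtFilter hc.continuousAt
  exact (h.const_mul _).const_add _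

theorem contDiff_gaussCdf : ContDiff ℝ ∞ gaussCdf := by
  rw [contDiff_infty_iff_deriv]
  refine ⟨fun z => (hasDerivAt_gaussCdf z).differentiableAt, ?_⟩
  have : deriv gaussCdf = fun z => (√Real.pi)⁻¹ * Real.exp (-z ^ 2) :=
    funext fun z => (hasDerivAt_gaussCdf z).deriv
  rw [this]
  fun_prop

theorem strictMono_gaussCdf : StrictMono gaussCdf :=
  strictMono_of_deriv_pos fun z => by
    rw [(hasDerivAt_gaussCdf z).deriv]
    have := sqrt_pi_pos
    positivity

theorem gaussCdf_add_neg (z : ℝ) : gaussCdf z + gaussCdf (-z) = 1 := by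
  have h := intervalIntegral.integral_comp_neg (a := 0) (b := z) fun y : ℝ => Real.exp (-y ^ 2)
  have h2 : (∫ y in (0 : ℝ)..z, Real.exp (-y ^ 2)) = -∫ y in (0 : ℝ)..(-z), Real.exp (-y ^ 2) := by
    rw [← intervalIntegral.integral_symm]
    simpa using h
  simp only [gaussCdf]
  rw [h2]
  ring

theorem tendsto_gaussCdf_atTop : Tendsto gaussCdf atTop (𝓝 1) := by
  have hi : IntegrableOn (fun y : ℝ => Real.exp (-y ^ 2)) (Ioi 0) := by
    simpa using (integrable_exp_neg_mul_sq one_pos).integrableOn (s := Ioi (0 : ℝ))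
  have h := intervalIntegral_tendsto_integral_Ioi 0 hi tendsto_id
  have hv : ∫ y in Ioi (0 : ℝ), Real.exp (-y ^ 2) = √Real.pi / 2 := by
    simpa using integral_gaussian_Ioi 1
  rw [hv] at h
  have h2 := (h.const_mul (√Real.pi)⁻¹).const_add (1 / 2)
  have e : 1 / 2 + (√Real.pi)⁻¹ * (√Real.pi / 2) = 1 := by
    have := sqrt_pi_pos.ne'
    field_simp
    norm_num
  rw [e] at h2
  exact h2

theorem tendsto_gaussCdf_atBot : Tendsto gaussCdf atBot (𝓝 0) := by
  have h := (tendsto_gaussCdf_atTop.comp tendsto_neg_atBot_atTop).const_sub 1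
  rw [sub_self] at h
  refine h.congr fun z => ?_
  have := gaussCdf_add_neg z
  simp only [Function.comp]
  linarith

theorem StrictMono.pos_of_tendsto_atBot {f : ℝ → ℝ} (hf : StrictMono f)
    (h : Tendsto f atBot (𝓝 0)) (r : ℝ) : 0 < f r :=
  (hf.monotone.le_of_tendsto h (r - 1)).trans_lt (hf (by linarith))

theorem gaussCdf_pos (z : ℝ) : 0 < gaussCdf z :=
  strictMono_gaussCdf.pos_of_tendsto_atBot tendsto_gaussCdf_atBot z

theorem gaussCdf_lt_one (z : ℝ) : gaussCdf z < 1 := by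
  linarith [gaussCdf_pos (-z), gaussCdf_add_neg z]

theorem abs_gaussCdf_sub_le (y z : ℝ) : |gaussCdf y - gaussCdf z| ≤ |y - z| := by
  have h := Convex.norm_image_sub_le_of_norm_hasDerivWithin_le (f := gaussCdf) (C := 1)
    (s := univ) (x := z) (y := y)
    (fun x _ => (hasDerivAt_gaussCdf x).hasDerivWithinAt) (fun x _ => ?_) convex_univ
    (mem_univ _) (mem_univ _)
  · simpa using h
  · rw [Real.norm_eq_abs, abs_of_nonneg (by have := sqrt_pi_pos; positivity)]
    have h1 : (√Real.pi)⁻¹ ≤ 1 := by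
      apply inv_le_one_of_one_le₀
      rw [Real.one_le_sqrt]
      linarith [Real.pi_gt_three]
    have h2 : Real.exp (-x ^ 2) ≤ 1 := by
      rw [Real.exp_le_one_iff]
      nlinarith [sq_nonneg x]
    exact mul_le_one₀ h1 (Real.exp_pos _).le h2

/-- The difference of the two sides is increasing on `[1, ∞)` and tends to `0`. This crude tail
suffices, since it only has to beat powers of `r`. -/
theorem gaussCdf_neg_le_exp {r : ℝ} (hr : 1 ≤ r) : gaussCdf (-r) ≤ Real.exp (-r) := by
  have hd : ∀ x, HasDerivAt (fun r => gaussCdf (-r) - Real.exp (-r))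
      (-((√Real.pi)⁻¹ * Real.exp (-x ^ 2)) + Real.exp (-x)) x := by
    intro x
    have h1 := (hasDerivAt_gaussCdf (-x)).comp x (hasDerivAt_neg x)
    have h2 := (Real.hasDerivAt_exp (-x)).comp x (hasDerivAt_neg x)
    refine (h1.sub h2).congr_deriv ?_
    simp
  have hm : MonotoneOn (fun r => gaussCdf (-r) - Real.exp (-r)) (Ici 1) := by
    refine monotoneOn_of_deriv_nonneg (convex_Ici 1)
      (fun x _ => (hd x).continuousAt.continuousWithinAt)
      (fun x _ => (hd x).differentiableAt.differentiableWithinAt) fun x hx => ?_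
    rw [interior_Ici] at hx
    have hx1 : 1 < x := hx
    rw [(hd x).deriv]
    have h1 : (√Real.pi)⁻¹ ≤ 1 := by
      apply inv_le_one_of_one_le₀
      rw [Real.one_le_sqrt]
      linarith [Real.pi_gt_three]
    have h2 : Real.exp (-x ^ 2) ≤ Real.exp (-x) := by
      rw [Real.exp_le_exp]
      nlinarith
    have : (√Real.pi)⁻¹ * Real.exp (-x ^ 2) ≤ 1 * Real.exp (-x) :=
      mul_le_mul h1 h2 (Real.exp_pos _).le zero_le_one
    linarith
  have hl : Tendsto (fun r => gaussCdf (-r) - Real.exp (-r)) atTop (𝓝 0) := by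
    have := (tendsto_gaussCdf_atBot.comp tendsto_neg_atTop_atBot).sub
      Real.tendsto_exp_neg_atTop_nhds_zero
    simpa using this
  have : gaussCdf (-r) - Real.exp (-r) ≤ 0 := by
    refine ge_of_tendsto hl ?_
    filter_upwards [eventually_ge_atTop r] with y hy
    exact hm hr (le_trans hr hy) hy
  linarith

theorem tendsto_pow_mul_gaussCdf (k : ℕ) :
    Tendsto (fun r => r ^ k * gaussCdf (-r)) atTop (𝓝 0) := by
  refine squeeze_zero' ?_ ?_ (Real.tendsto_pow_mul_exp_neg_atTop_nhds_zero k)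
  · filter_upwards [eventually_ge_atTop 0] with r hr
    have := gaussCdf_pos (-r)
    positivity
  · filter_upwards [eventually_ge_atTop 1] with r hr
    exact mul_le_mul_of_nonneg_left (gaussCdf_neg_le_exp hr) (by positivity)

theorem tendsto_pow_mul_exp_neg_sq (k : ℕ) :
    Tendsto (fun r => r ^ k * Real.exp (-r ^ 2)) atTop (𝓝 0) := by
  refine squeeze_zero' ?_ ?_ (Real.tendsto_pow_mul_exp_neg_atTop_nhds_zero k)
  · filter_upwards [eventually_ge_atTop 0] with r hr
    positivity
  · filter_upwards [eventually_ge_atTop 1] with r hr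
    refine mul_le_mul_of_nonneg_left ?_ (by positivity)
    rw [Real.exp_le_exp]
    nlinarith

/-- The Mills function `exp (r²) gaussCdf r = π^(-1/2) ∫₀^∞ exp (2 r y - y²) dy`. -/
noncomputable def mills (r : ℝ) : ℝ := Real.exp (r ^ 2) * gaussCdf r

/-- The derivative of `mills`. -/
noncomputable def millsD (r : ℝ) : ℝ := 2 * r * mills r + (√Real.pi)⁻¹

theorem exp_sq_mul_exp_neg_sq (r : ℝ) : Real.exp (r ^ 2) * Real.exp (-r ^ 2) = 1 := by
  rw [← Real.exp_add]; simp

theorem hasDerivAt_exp_neg_sq (r : ℝ) :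
    HasDerivAt (fun r : ℝ => Real.exp (-r ^ 2)) (-(2 * r) * Real.exp (-r ^ 2)) r := by
  have h := ((hasDerivAt_pow 2 r).fun_neg).exp
  refine h.congr_deriv ?_
  simp
  ring

theorem hasDerivAt_mills (r : ℝ) : HasDerivAt mills (millsD r) r := by
  have h := ((hasDerivAt_pow 2 r).exp).mul (hasDerivAt_gaussCdf r)
  refine h.congr_deriv ?_
  simp only [millsD, mills]
  have := exp_sq_mul_exp_neg_sq r
  push_cast
  linear_combination (√Real.pi)⁻¹ * this

theorem hasDerivAt_millsD (r : ℝ) : HasDerivAt millsD (2 * mills r + 2 * r * millsD r) r := by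
  have h := (((hasDerivAt_id r).const_mul 2).mul (hasDerivAt_mills r)).add_const (√Real.pi)⁻¹
  refine h.congr_deriv ?_
  simp

theorem continuous_mills : Continuous mills :=
  continuous_iff_continuousAt.2 fun r => (hasDerivAt_mills r).continuousAt

theorem continuous_millsD : Continuous millsD :=
  continuous_iff_continuousAt.2 fun r => (hasDerivAt_millsD r).continuousAt

theorem mills_pos (r : ℝ) : 0 < mills r := mul_pos (Real.exp_pos _) (gaussCdf_pos r)

theorem mills_zero : mills 0 = 1 / 2 := by simp [mills, gaussCdf_zero]

theorem mills_le_exp (r : ℝ) : mills r ≤ Real.exp (r ^ 2) :=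
  mul_le_of_le_one_right (Real.exp_pos _).le (gaussCdf_lt_one r).le

theorem half_exp_le_mills {r : ℝ} (hr : 0 ≤ r) : Real.exp (r ^ 2) / 2 ≤ mills r := by
  have : 1 / 2 ≤ gaussCdf r := gaussCdf_zero ▸ strictMono_gaussCdf.monotone hr
  have h := mul_le_mul_of_nonneg_left this (Real.exp_pos (r ^ 2)).le
  simp only [mills]
  linarith

theorem pos_of_hasDerivAt_pos_of_tendsto {f f' : ℝ → ℝ} (hf : ∀ r, HasDerivAt f (f' r) r)
    (hp : ∀ r, 0 < f' r) (h : Tendsto (fun r => f (-r)) atTop (𝓝 0)) (r : ℝ) : 0 < f r := by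
  have hm : StrictMono f := strictMono_of_deriv_pos fun z => by rw [(hf z).deriv]; exact hp z
  refine hm.pos_of_tendsto_atBot ?_ r
  have := h.comp tendsto_neg_atBot_atTop
  refine this.congr fun z => ?_
  simp

/-- This function and the next two are `exp (-r²)` times `M'`, `M''`, `M'''`. From `M⁽ⁿ⁺¹⁾ = 2 r
M⁽ⁿ⁾ + 2 n M⁽ⁿ⁻¹⁾` the weighted `n`-th derivative has derivative `2n` times the weighted `(n-1)`-st
one. Each vanishes at `-∞`, so positivity passes from each order to the next. -/
theorem weighted_millsD_pos (r : ℝ) :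
    0 < 2 * r * gaussCdf r + (√Real.pi)⁻¹ * Real.exp (-r ^ 2) := by
  refine pos_of_hasDerivAt_pos_of_tendsto (f := fun r => 2 * r * gaussCdf r + (√Real.pi)⁻¹ * Real.exp (-r ^ 2))
    (f' := fun r => 2 * gaussCdf r) (fun r => ?_)
    (fun r => by have := gaussCdf_pos r; positivity) ?_ r
  · have h := (((hasDerivAt_id r).const_mul 2).mul (hasDerivAt_gaussCdf r)).add
      ((hasDerivAt_exp_neg_sq r).const_mul (√Real.pi)⁻¹)
    refine h.congr_deriv ?_
    simp
    ring
  · have := ((tendsto_pow_mul_gaussCdf 1).const_mul (-2)).add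
      ((tendsto_pow_mul_exp_neg_sq 0).const_mul (√Real.pi)⁻¹)
    simp only [mul_zero, add_zero] at this
    refine this.congr fun r => ?_
    simp
    ring

theorem weighted_millsDD_pos (r : ℝ) :
    0 < (2 + 4 * r ^ 2) * gaussCdf r + 2 * r * ((√Real.pi)⁻¹ * Real.exp (-r ^ 2)) := by
  refine pos_of_hasDerivAt_pos_of_tendsto
    (f := fun r => (2 + 4 * r ^ 2) * gaussCdf r + 2 * r * ((√Real.pi)⁻¹ * Real.exp (-r ^ 2)))
    (f' := fun r => 4 * (2 * r * gaussCdf r + (√Real.pi)⁻¹ * Real.exp (-r ^ 2))) (fun r => ?_)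
    (fun r => by have := weighted_millsD_pos r; positivity) ?_ r
  · have h := ((((hasDerivAt_pow 2 r).const_mul 4).const_add 2).mul (hasDerivAt_gaussCdf r)).add
      (((hasDerivAt_id r).const_mul 2).mul ((hasDerivAt_exp_neg_sq r).const_mul (√Real.pi)⁻¹))
    refine h.congr_deriv ?_
    simp
    ring
  · have := (((tendsto_pow_mul_gaussCdf 0).const_mul 2).add
      ((tendsto_pow_mul_gaussCdf 2).const_mul 4)).add
      ((tendsto_pow_mul_exp_neg_sq 1).const_mul (-2 * (√Real.pi)⁻¹))
    simp only [mul_zero, add_zero] at this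
    refine this.congr fun r => ?_
    simp
    ring

theorem weighted_millsDDD_pos (r : ℝ) :
    0 < (12 * r + 8 * r ^ 3) * gaussCdf r
      + (4 + 4 * r ^ 2) * ((√Real.pi)⁻¹ * Real.exp (-r ^ 2)) := by
  refine pos_of_hasDerivAt_pos_of_tendsto
    (f := fun r => (12 * r + 8 * r ^ 3) * gaussCdf r
      + (4 + 4 * r ^ 2) * ((√Real.pi)⁻¹ * Real.exp (-r ^ 2)))
    (f' := fun r => 6 * ((2 + 4 * r ^ 2) * gaussCdf r
      + 2 * r * ((√Real.pi)⁻¹ * Real.exp (-r ^ 2)))) (fun r => ?_)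
    (fun r => by have := weighted_millsDD_pos r; positivity) ?_ r
  · have h := ((((hasDerivAt_id r).const_mul 12).add ((hasDerivAt_pow 3 r).const_mul 8)).mul
      (hasDerivAt_gaussCdf r)).add
      ((((hasDerivAt_pow 2 r).const_mul 4).const_add 4).mul
        ((hasDerivAt_exp_neg_sq r).const_mul (√Real.pi)⁻¹))
    refine h.congr_deriv ?_
    simp
    ring
  · have := (((tendsto_pow_mul_gaussCdf 1).const_mul (-12)).add
      ((tendsto_pow_mul_gaussCdf 3).const_mul (-8))).add
      (((tendsto_pow_mul_exp_neg_sq 0).const_mul (4 * (√Real.pi)⁻¹)).add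
        ((tendsto_pow_mul_exp_neg_sq 2).const_mul (4 * (√Real.pi)⁻¹)))
    simp only [mul_zero, add_zero] at this
    refine this.congr fun r => ?_
    simp
    ring

theorem millsD_pos (r : ℝ) : 0 < millsD r := by
  have h := mul_pos (Real.exp_pos (r ^ 2)) (weighted_millsD_pos r)
  simp only [millsD, mills]
  linear_combination h + (√Real.pi)⁻¹ * exp_sq_mul_exp_neg_sq r

theorem strictMono_mills : StrictMono mills :=
  strictMono_of_deriv_pos fun z => by rw [(hasDerivAt_mills z).deriv]; exact millsD_pos z

/-- The expression is `M''/2`. -/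
theorem mills_add_mul_millsD_pos (r : ℝ) : 0 < mills r + r * millsD r := by
  have h := mul_pos (Real.exp_pos (r ^ 2)) (weighted_millsDD_pos r)
  simp only [millsD, mills]
  linear_combination h / 2 + r * (√Real.pi)⁻¹ * exp_sq_mul_exp_neg_sq r

/-- The expression is `M'''/4`. -/
theorem millsDDD_pos (r : ℝ) : 0 < r * mills r + (1 + r ^ 2) * millsD r := by
  have h := mul_pos (Real.exp_pos (r ^ 2)) (weighted_millsDDD_pos r)
  simp only [millsD, mills]
  linear_combination h / 4 + (1 + r ^ 2) * (√Real.pi)⁻¹ * exp_sq_mul_exp_neg_sq r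

/-- `r · mills (-r)` tends to `1 / (2 √π)` at infinity. -/
theorem tendsto_mul_mills_neg :
    Tendsto (fun r => r * mills (-r)) atTop (𝓝 ((√Real.pi)⁻¹ / 2)) := by
  have hinv : Tendsto (fun r : ℝ => (r ^ 2)⁻¹) atTop (𝓝 0) :=
    (tendsto_pow_atTop two_ne_zero).inv_tendsto_atTop
  have hl : Tendsto (fun r : ℝ => (√Real.pi)⁻¹ / ((r ^ 2)⁻¹ + 2)) atTop (𝓝 ((√Real.pi)⁻¹ / 2)) := by
    have := (tendsto_const_nhds (x := (√Real.pi)⁻¹)).div (hinv.add_const 2) (by norm_num)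
    rw [zero_add] at this
    exact this
  refine tendsto_of_tendsto_of_tendsto_of_le_of_le' hl tendsto_const_nhds ?_ ?_
  · filter_upwards [eventually_gt_atTop 0] with r hr
    -- `M''(-r) > 0` reads `(1 + 2r²) M(-r) > r/√π`, the lower bound. The upper bound below is
    -- `M'(-r) > 0`.
    have h := mills_add_mul_millsD_pos (-r)
    simp only [millsD] at h
    have e : (r ^ 2)⁻¹ + 2 = (1 + 2 * r ^ 2) / r ^ 2 := by field_simp
    rw [e, div_div_eq_mul_div, div_le_iff₀ (by positivity)]
    nlinarith
  · refine Eventually.of_forall fun r => ?_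
    have := millsD_pos (-r)
    simp only [millsD] at this
    linarith

/-- `r² · millsD (-r)` tends to `1 / (2 √π)` at infinity. -/
theorem tendsto_sq_mul_millsD_neg :
    Tendsto (fun r => r ^ 2 * millsD (-r)) atTop (𝓝 ((√Real.pi)⁻¹ / 2)) := by
  have hinv : Tendsto (fun r : ℝ => (r ^ 2)⁻¹) atTop (𝓝 0) :=
    (tendsto_pow_atTop two_ne_zero).inv_tendsto_atTop
  have hl : Tendsto (fun r : ℝ => r * mills (-r) / ((r ^ 2)⁻¹ + 1)) atTop
      (𝓝 ((√Real.pi)⁻¹ / 2)) := by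
    have := tendsto_mul_mills_neg.div (hinv.add_const 1) (by norm_num)
    rw [zero_add, div_one] at this
    exact this
  refine tendsto_of_tendsto_of_tendsto_of_le_of_le' hl tendsto_mul_mills_neg ?_ ?_
  · filter_upwards [eventually_gt_atTop 0] with r hr
    -- `M'''(-r) > 0` bounds `M'(-r)` below by `r M(-r)/(1 + r²)`; the upper bound `r M'(-r) <
    -- M(-r)` is `M''(-r) > 0`.
    have h := millsDDD_pos (-r)
    have e : (r ^ 2)⁻¹ + 1 = (1 + r ^ 2) / r ^ 2 := by field_simp
    rw [e, div_div_eq_mul_div, div_le_iff₀ (by positivity)]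
    nlinarith [mul_pos (sq_pos_of_pos hr) h]
  · filter_upwards [eventually_gt_atTop 0] with r hr
    have h := mills_add_mul_millsD_pos (-r)
    nlinarith [mul_pos hr h]

/-! ### Elementary solutions of the heat equation -/

/-- The heat kernel of `w_t = ε w_xx`. -/
noncomputable def heatKer (ε x t : ℝ) : ℝ :=
  Real.exp (-x ^ 2 / (4 * ε * t)) * (√Real.pi)⁻¹ / √(4 * ε * t)

/-- The integral `∫₀^∞ heatKer ε (x + y) t * exp (ν y) dy` in closed form. -/
noncomputable def heatTail (ε ν x t : ℝ) : ℝ :=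
  Real.exp (ε * ν ^ 2 * t - ν * x) * gaussCdf ((2 * ε * ν * t - x) / √(4 * ε * t))

/-- The derivative of `heatTail` with respect to `ν`. -/
noncomputable def heatTailD (ε ν x t : ℝ) : ℝ :=
  (2 * ε * ν * t - x) * heatTail ε ν x t + 2 * ε * t * heatKer ε x t

section Derivatives

variable {ε t : ℝ}

theorem hasDerivAt_sqrt_four_mul (hε : 0 < ε) (ht : 0 < t) :
    HasDerivAt (fun t => √(4 * ε * t)) (√(4 * ε * t) / (2 * t)) t := by
  have hp : 0 < 4 * ε * t := by positivity
  have h := ((hasDerivAt_id t).const_mul (4 * ε)).sqrt hp.ne'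
  refine h.congr_deriv ?_
  have hs := Real.sq_sqrt hp.le
  have hs0 : 0 < √(4 * ε * t) := Real.sqrt_pos.2 hp
  simp only [id]
  field_simp
  linear_combination -hs

theorem exp_mul_exp_neg_sq (hε : 0 < ε) (ht : 0 < t) (ν x : ℝ) :
    Real.exp (ε * ν ^ 2 * t - ν * x) * Real.exp (-((2 * ε * ν * t - x) / √(4 * ε * t)) ^ 2)
      = Real.exp (-x ^ 2 / (4 * ε * t)) := by
  rw [← Real.exp_add, div_pow, Real.sq_sqrt (by positivity)]
  congr 1
  field_simp
  ring

theorem hasDerivAt_heatKer_x (hε : 0 < ε) (ht : 0 < t) (x : ℝ) :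
    HasDerivAt (fun x => heatKer ε x t) (-x / (2 * ε * t) * heatKer ε x t) x := by
  have h := ((((hasDerivAt_pow 2 x).fun_neg.div_const (4 * ε * t)).exp).mul_const
    (√Real.pi)⁻¹).div_const (√(4 * ε * t))
  refine h.congr_deriv ?_
  have hs0 : 0 < √(4 * ε * t) := Real.sqrt_pos.2 (by positivity)
  simp only [heatKer]
  field_simp
  ring

theorem hasDerivAt_heatKer_t (hε : 0 < ε) (ht : 0 < t) (x : ℝ) :
    HasDerivAt (fun t => heatKer ε x t)
      ((x ^ 2 / (4 * ε * t ^ 2) - 1 / (2 * t)) * heatKer ε x t) t := by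
  have hs0 : 0 < √(4 * ε * t) := Real.sqrt_pos.2 (by positivity)
  have h1 := (hasDerivAt_const t (-x ^ 2)).fun_div ((hasDerivAt_id t).const_mul (4 * ε))
    (by simp only [id]; positivity)
  have h := ((h1.exp).mul_const (√Real.pi)⁻¹).fun_div (hasDerivAt_sqrt_four_mul hε ht) hs0.ne'
  refine h.congr_deriv ?_
  simp only [heatKer, id]
  field_simp
  ring

theorem hasDerivAt_heatTail_x (hε : 0 < ε) (ht : 0 < t) (ν x : ℝ) :
    HasDerivAt (fun x => heatTail ε ν x t) (-ν * heatTail ε ν x t - heatKer ε x t) x := by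
  have hs0 : 0 < √(4 * ε * t) := Real.sqrt_pos.2 (by positivity)
  have h1 := (((hasDerivAt_id x).const_mul ν).const_sub (ε * ν ^ 2 * t)).exp
  have h2 := (hasDerivAt_gaussCdf ((2 * ε * ν * t - x) / √(4 * ε * t))).comp x
    (((hasDerivAt_id x).const_sub (2 * ε * ν * t)).div_const (√(4 * ε * t)))
  refine (h1.fun_mul h2).congr_deriv ?_
  have he := exp_mul_exp_neg_sq hε ht ν x
  simp only [heatKer, heatTail, id, Function.comp, ← he]
  ring

theorem hasDerivAt_heatTail_t (hε : 0 < ε) (ht : 0 < t) (ν x : ℝ) :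
    HasDerivAt (fun t => heatTail ε ν x t)
      (ε * ν ^ 2 * heatTail ε ν x t + (ε * ν + x / (2 * t)) * heatKer ε x t) t := by
  have hs0 : 0 < √(4 * ε * t) := Real.sqrt_pos.2 (by positivity)
  have h1 := (((hasDerivAt_id t).const_mul (ε * ν ^ 2)).sub_const (ν * x)).exp
  have h2 := (hasDerivAt_gaussCdf ((2 * ε * ν * t - x) / √(4 * ε * t))).comp t
    ((((hasDerivAt_id t).const_mul (2 * ε * ν)).sub_const x).fun_div
      (hasDerivAt_sqrt_four_mul hε ht) hs0.ne')
  refine (h1.fun_mul h2).congr_deriv ?_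
  have he := exp_mul_exp_neg_sq hε ht ν x
  simp only [heatKer, heatTail, id, Function.comp, ← he]
  field_simp
  ring

theorem hasDerivAt_heatTailD_x (hε : 0 < ε) (ht : 0 < t) (ν x : ℝ) :
    HasDerivAt (fun x => heatTailD ε ν x t) (-ν * heatTailD ε ν x t - heatTail ε ν x t) x := by
  have h := (((hasDerivAt_id x).const_sub (2 * ε * ν * t)).fun_mul
    (hasDerivAt_heatTail_x hε ht ν x)).fun_add
    ((hasDerivAt_heatKer_x hε ht x).const_mul (2 * ε * t))
  refine h.congr_deriv ?_
  simp only [heatTailD, id]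
  field_simp
  ring

theorem hasDerivAt_heatTailD_t (hε : 0 < ε) (ht : 0 < t) (ν x : ℝ) :
    HasDerivAt (fun t => heatTailD ε ν x t)
      (2 * ε * ν * heatTail ε ν x t + ε * ν ^ 2 * heatTailD ε ν x t + ε * heatKer ε x t) t := by
  have h := ((((hasDerivAt_id t).const_mul (2 * ε * ν)).sub_const x).fun_mul
    (hasDerivAt_heatTail_t hε ht ν x)).fun_add
    (((hasDerivAt_id t).const_mul (2 * ε)).fun_mul (hasDerivAt_heatKer_t hε ht x))
  refine h.congr_deriv ?_
  simp only [heatTailD, id]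
  field_simp
  ring

end Derivatives

/-- `f` is a `C²` solution of `f_t = ε f_xx` on the upper half plane. -/
structure IsCaloric (ε : ℝ) (f : ℝ → ℝ → ℝ) : Prop where
  contDiffOn : ContDiffOn ℝ 2 (fun p : ℝ × ℝ => f p.1 p.2) (univ ×ˢ Ioi 0)
  heat : ∃ fx fxx : ℝ → ℝ → ℝ, ∀ x, ∀ t > 0, HasDerivAt (fun x => f x t) (fx x t) x ∧
    HasDerivAt (fun x => fx x t) (fxx x t) x ∧ HasDerivAt (fun t => f x t) (ε * fxx x t) t

namespace IsCaloric

variable {ε : ℝ} {f g : ℝ → ℝ → ℝ}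

theorem add (hf : IsCaloric ε f) (hg : IsCaloric ε g) :
    IsCaloric ε (fun x t => f x t + g x t) := by
  refine ⟨hf.contDiffOn.add hg.contDiffOn, ?_⟩
  obtain ⟨fx, fxx, h⟩ := hf.heat
  obtain ⟨gx, gxx, k⟩ := hg.heat
  refine ⟨fun x t => fx x t + gx x t, fun x t => fxx x t + gxx x t, fun x t ht => ?_⟩
  obtain ⟨h1, h2, h3⟩ := h x t ht
  obtain ⟨k1, k2, k3⟩ := k x t ht
  exact ⟨h1.fun_add k1, h2.fun_add k2, (h3.fun_add k3).congr_deriv (by ring)⟩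

theorem const_mul (c : ℝ) (hf : IsCaloric ε f) : IsCaloric ε (fun x t => c * f x t) := by
  refine ⟨contDiffOn_const.mul hf.contDiffOn, ?_⟩
  obtain ⟨fx, fxx, h⟩ := hf.heat
  refine ⟨fun x t => c * fx x t, fun x t => c * fxx x t, fun x t ht => ?_⟩
  obtain ⟨h1, h2, h3⟩ := h x t ht
  exact ⟨h1.const_mul c, h2.const_mul c, (h3.const_mul c).congr_deriv (by ring)⟩

theorem sub (hf : IsCaloric ε f) (hg : IsCaloric ε g) :
    IsCaloric ε (fun x t => f x t - g x t) := by
  have := hf.add (hg.const_mul (-1))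
  simpa only [neg_one_mul, ← sub_eq_add_neg] using this

theorem deriv_eq (hf : IsCaloric ε f) (x : ℝ) {t : ℝ} (ht : 0 < t) :
    deriv (fun s => f x s) t = ε * deriv (deriv (fun y => f y t)) x := by
  obtain ⟨fx, fxx, h⟩ := hf.heat
  have e : deriv (fun y => f y t) = fun y => fx y t := funext fun y => (h y t ht).1.deriv
  rw [(h x t ht).2.2.deriv, e, (h x t ht).2.1.deriv]

theorem exp_sub (ε μ : ℝ) : IsCaloric ε (fun x t => Real.exp (ε * μ ^ 2 * t - μ * x)) := by
  refine ⟨by fun_prop, fun x t => -μ * Real.exp (ε * μ ^ 2 * t - μ * x),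
    fun x t => -μ * (-μ * Real.exp (ε * μ ^ 2 * t - μ * x)), fun x t _ => ?_⟩
  have h : HasDerivAt (fun x => Real.exp (ε * μ ^ 2 * t - μ * x))
      (-μ * Real.exp (ε * μ ^ 2 * t - μ * x)) x := by
    refine (((hasDerivAt_id x).const_mul μ).const_sub (ε * μ ^ 2 * t)).exp.congr_deriv ?_
    simp only [id]
    ring
  refine ⟨h, h.const_mul _, ?_⟩
  refine (((hasDerivAt_id t).const_mul (ε * μ ^ 2)).sub_const (μ * x)).exp.congr_deriv ?_
  simp only [id]
  ring

end IsCaloric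

theorem contDiffOn_inv_sqrt {ε : ℝ} (hε : 0 < ε) :
    ContDiffOn ℝ 2 (fun p : ℝ × ℝ => (√(4 * ε * p.2))⁻¹) (univ ×ˢ Ioi 0) := by
  have hpos : ∀ p ∈ (univ ×ˢ Ioi 0 : Set (ℝ × ℝ)), 0 < 4 * ε * p.2 := fun p hp => by
    have : 0 < p.2 := hp.2
    positivity
  refine ContDiffOn.inv (ContDiffOn.sqrt (by fun_prop) fun p hp => (hpos p hp).ne') fun p hp => ?_
  exact (Real.sqrt_pos.2 (hpos p hp)).ne'

theorem contDiffOn_heatTail {ε : ℝ} (hε : 0 < ε) (ν : ℝ) :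
    ContDiffOn ℝ 2 (fun p : ℝ × ℝ => heatTail ε ν p.1 p.2) (univ ×ˢ Ioi 0) := by
  have h : ContDiffOn ℝ 2 (fun p : ℝ × ℝ => (2 * ε * ν * p.2 - p.1) / √(4 * ε * p.2))
      (univ ×ˢ Ioi 0) := by
    have h1 : ContDiffOn ℝ 2 (fun p : ℝ × ℝ => 2 * ε * ν * p.2 - p.1) (univ ×ˢ Ioi 0) := by
      fun_prop
    simpa only [div_eq_mul_inv] using h1.mul (contDiffOn_inv_sqrt hε)
  have h2 := (contDiff_gaussCdf.of_le (m := 2) (by norm_cast)).comp_contDiffOn h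
  have h3 : ContDiffOn ℝ 2 (fun p : ℝ × ℝ => Real.exp (ε * ν ^ 2 * p.2 - ν * p.1))
      (univ ×ˢ Ioi 0) := by fun_prop
  exact h3.mul h2

theorem contDiffOn_heatKer {ε : ℝ} (hε : 0 < ε) :
    ContDiffOn ℝ 2 (fun p : ℝ × ℝ => heatKer ε p.1 p.2) (univ ×ˢ Ioi 0) := by
  have hpos : ∀ p ∈ (univ ×ˢ Ioi 0 : Set (ℝ × ℝ)), 4 * ε * p.2 ≠ 0 := fun p hp => by
    have : 0 < p.2 := hp.2
    positivity
  have h1 : ContDiffOn ℝ 2 (fun p : ℝ × ℝ => -p.1 ^ 2 / (4 * ε * p.2)) (univ ×ˢ Ioi 0) :=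
    ContDiffOn.div (by fun_prop) (by fun_prop) hpos
  have h := (h1.exp.mul (contDiffOn_const (c := (√Real.pi)⁻¹))).mul (contDiffOn_inv_sqrt hε)
  exact h

theorem isCaloric_heatTail {ε : ℝ} (hε : 0 < ε) (ν : ℝ) : IsCaloric ε (heatTail ε ν) := by
  refine ⟨contDiffOn_heatTail hε ν, fun x t => -ν * heatTail ε ν x t - heatKer ε x t,
    fun x t => -ν * (-ν * heatTail ε ν x t - heatKer ε x t) - -x / (2 * ε * t) * heatKer ε x t,
    fun x t ht => ⟨hasDerivAt_heatTail_x hε ht ν x, ?_, ?_⟩⟩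
  · exact ((hasDerivAt_heatTail_x hε ht ν x).const_mul _).fun_sub (hasDerivAt_heatKer_x hε ht x)
  · refine (hasDerivAt_heatTail_t hε ht ν x).congr_deriv ?_
    field_simp
    ring

theorem isCaloric_heatTailD {ε : ℝ} (hε : 0 < ε) (ν : ℝ) : IsCaloric ε (heatTailD ε ν) := by
  refine ⟨?_, fun x t => -ν * heatTailD ε ν x t - heatTail ε ν x t,
    fun x t => -ν * (-ν * heatTailD ε ν x t - heatTail ε ν x t)
      - (-ν * heatTail ε ν x t - heatKer ε x t),
    fun x t ht => ⟨hasDerivAt_heatTailD_x hε ht ν x, ?_, ?_⟩⟩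
  · have h1 : ContDiffOn ℝ 2 (fun p : ℝ × ℝ => 2 * ε * ν * p.2 - p.1) (univ ×ˢ Ioi 0) := by
      fun_prop
    have h2 : ContDiffOn ℝ 2 (fun p : ℝ × ℝ => 2 * ε * p.2) (univ ×ˢ Ioi 0) := by
      fun_prop
    exact (h1.mul (contDiffOn_heatTail hε ν)).add (h2.mul (contDiffOn_heatKer hε))
  · exact ((hasDerivAt_heatTailD_x hε ht ν x).const_mul _).fun_sub
      (hasDerivAt_heatTail_x hε ht ν x)
  · refine (hasDerivAt_heatTailD_t hε ht ν x).congr_deriv ?_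
    ring

/-! ### Initial values -/

/-- The filter of points with `x ≥ 0`, `t > 0` tending to `(x₀, 0)`. -/
noncomputable abbrev initialFilter (x₀ : ℝ) : Filter (ℝ × ℝ) := 𝓝[Ici 0 ×ˢ Ioi 0] (x₀, 0)

theorem tendsto_sqrt_initialFilter (ε x₀ : ℝ) :
    Tendsto (fun p : ℝ × ℝ => √(4 * ε * p.2)) (initialFilter x₀) (𝓝 0) := by
  have h : Continuous fun p : ℝ × ℝ => √(4 * ε * p.2) := by fun_prop
  have := (h.tendsto (x₀, 0)).mono_left (nhdsWithin_le_nhds (s := Ici 0 ×ˢ Ioi 0))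
  simpa using this

/-- For `x₀ > 0` the argument of `Φ` tends to `-∞`. At the corner `x₀ = 0` it has no limit, so there
the factor `f` must vanish. -/
theorem tendsto_mul_gaussCdf_initialFilter {ε x₀ : ℝ} (hε : 0 < ε) (hx₀ : 0 ≤ x₀) (ν : ℝ)
    {f : ℝ × ℝ → ℝ} (hf : Continuous f) (h0 : x₀ = 0 → f (0, 0) = 0) :
    Tendsto (fun p => f p * gaussCdf ((2 * ε * ν * p.2 - p.1) / √(4 * ε * p.2)))
      (initialFilter x₀) (𝓝 0) := by
  have hfl := (hf.tendsto (x₀, 0)).mono_left (nhdsWithin_le_nhds (s := Ici 0 ×ˢ Ioi 0))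
  rcases hx₀.eq_or_lt with rfl | hpos
  · rw [h0 rfl] at hfl
    refine squeeze_zero_norm (fun p => ?_) (by simpa using hfl.norm)
    rw [norm_mul, Real.norm_of_nonneg (gaussCdf_pos _).le]
    exact mul_le_of_le_one_right (norm_nonneg _) (gaussCdf_lt_one _).le
  · have hs : Tendsto (fun p : ℝ × ℝ => √(4 * ε * p.2)) (initialFilter x₀) (𝓝[>] 0) := by
      refine tendsto_nhdsWithin_iff.2 ⟨tendsto_sqrt_initialFilter ε x₀, ?_⟩
      filter_upwards [self_mem_nhdsWithin] with p hp
      have : 0 < p.2 := hp.2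
      exact Real.sqrt_pos.2 (by positivity)
    have hn : Tendsto (fun p : ℝ × ℝ => 2 * ε * ν * p.2 - p.1) (initialFilter x₀) (𝓝 (-x₀)) := by
      have h : Continuous fun p : ℝ × ℝ => 2 * ε * ν * p.2 - p.1 := by fun_prop
      have := (h.tendsto (x₀, 0)).mono_left (nhdsWithin_le_nhds (s := Ici 0 ×ˢ Ioi 0))
      simpa using this
    have := tendsto_gaussCdf_atBot.comp
      (hn.neg_mul_atTop (neg_lt_zero.2 hpos) hs.inv_tendsto_nhdsGT_zero)
    simpa [div_eq_mul_inv] using hfl.mul this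

/-- The singular part `x/√(4εt)` is common to both arguments, which differ only by `(ν -
ν')√(4εt)/2`; `Φ` is Lipschitz. Thus differences of tails are continuous at the corner although
single tails are not. -/
theorem tendsto_gaussCdf_sub_initialFilter {ε : ℝ} (hε : 0 < ε) (x₀ ν ν' : ℝ) :
    Tendsto (fun p : ℝ × ℝ => gaussCdf ((2 * ε * ν * p.2 - p.1) / √(4 * ε * p.2))
      - gaussCdf ((2 * ε * ν' * p.2 - p.1) / √(4 * ε * p.2))) (initialFilter x₀) (𝓝 0) := by
  have h := (tendsto_sqrt_initialFilter ε x₀).const_mul (|ν - ν'| / 2)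
  rw [mul_zero] at h
  refine squeeze_zero_norm' ?_ h
  filter_upwards [self_mem_nhdsWithin] with p hp
  have hp2 : 0 < p.2 := hp.2
  have h4 : 0 < 4 * ε * p.2 := by positivity
  have hs := Real.sq_sqrt h4.le
  have hs0 := Real.sqrt_pos.2 h4
  refine (abs_gaussCdf_sub_le _ _).trans (le_of_eq ?_)
  have e : (2 * ε * ν * p.2 - p.1) / √(4 * ε * p.2) - (2 * ε * ν' * p.2 - p.1) / √(4 * ε * p.2)
      = (ν - ν') * (√(4 * ε * p.2) / 2) := by
    generalize √(4 * ε * p.2) = s at hs hs0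
    field_simp
    linear_combination -(ν - ν') * hs
  rw [e, abs_mul, abs_of_pos (half_pos hs0)]
  ring

theorem tendsto_heatTail_sub_initialFilter {ε x₀ : ℝ} (hε : 0 < ε) (hx₀ : 0 ≤ x₀) (ν ν' : ℝ) :
    Tendsto (fun p : ℝ × ℝ => heatTail ε ν p.1 p.2 - heatTail ε ν' p.1 p.2)
      (initialFilter x₀) (𝓝 0) := by
  have h1 := tendsto_mul_gaussCdf_initialFilter hε hx₀ ν
    (f := fun p => Real.exp (ε * ν ^ 2 * p.2 - ν * p.1) - Real.exp (ε * ν' ^ 2 * p.2 - ν' * p.1))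
    (by fun_prop) (fun _ => by simp)
  have h : Continuous fun p : ℝ × ℝ => Real.exp (ε * ν' ^ 2 * p.2 - ν' * p.1) := by fun_prop
  have h2 := ((h.tendsto (x₀, 0)).mono_left (nhdsWithin_le_nhds (s := Ici 0 ×ˢ Ioi 0))).mul
    (tendsto_gaussCdf_sub_initialFilter hε x₀ ν ν')
  have h3 := h1.add h2
  rw [mul_zero, add_zero] at h3
  refine h3.congr fun p => ?_
  simp only [heatTail]
  ring

theorem two_mul_mul_heatKer {ε t : ℝ} (hε : 0 < ε) (ht : 0 < t) (x : ℝ) :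
    2 * ε * t * heatKer ε x t
      = Real.exp (-x ^ 2 / (4 * ε * t)) * (√Real.pi)⁻¹ / 2 * √(4 * ε * t) := by
  have h4 : 0 < 4 * ε * t := by positivity
  have hs := Real.sq_sqrt h4.le
  have hs0 := Real.sqrt_pos.2 h4
  have := sqrt_pi_pos
  simp only [heatKer]
  generalize Real.exp (-x ^ 2 / (4 * ε * t)) = e
  generalize √(4 * ε * t) = s at hs hs0
  field_simp
  linear_combination -e * hs

theorem abs_two_mul_mul_heatKer_le {ε t : ℝ} (hε : 0 < ε) (ht : 0 < t) (x : ℝ) :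
    |2 * ε * t * heatKer ε x t| ≤ √(4 * ε * t) := by
  have hp := sqrt_pi_pos
  rw [two_mul_mul_heatKer hε ht, abs_of_nonneg (by positivity)]
  refine mul_le_of_le_one_left (Real.sqrt_nonneg _) ?_
  have h1 : (√Real.pi)⁻¹ ≤ 1 := by
    apply inv_le_one_of_one_le₀
    rw [Real.one_le_sqrt]
    linarith [Real.pi_gt_three]
  have h2 : Real.exp (-x ^ 2 / (4 * ε * t)) ≤ 1 := by
    rw [Real.exp_le_one_iff, neg_div]
    have : 0 ≤ x ^ 2 / (4 * ε * t) := by positivity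
    linarith
  have := mul_le_one₀ h2 (by positivity) h1
  linarith

theorem tendsto_heatTailD_initialFilter {ε x₀ : ℝ} (hε : 0 < ε) (hx₀ : 0 ≤ x₀) (ν : ℝ) :
    Tendsto (fun p : ℝ × ℝ => heatTailD ε ν p.1 p.2) (initialFilter x₀) (𝓝 0) := by
  have h1 := tendsto_mul_gaussCdf_initialFilter hε hx₀ ν
    (f := fun p => (2 * ε * ν * p.2 - p.1) * Real.exp (ε * ν ^ 2 * p.2 - ν * p.1))
    (by fun_prop) (fun _ => by simp)
  have h2 : Tendsto (fun p : ℝ × ℝ => 2 * ε * p.2 * heatKer ε p.1 p.2) (initialFilter x₀)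
      (𝓝 0) := by
    refine squeeze_zero_norm' ?_ (tendsto_sqrt_initialFilter ε x₀)
    filter_upwards [self_mem_nhdsWithin] with p hp
    exact abs_two_mul_mul_heatKer_le hε hp.2 _
  have h3 := h1.add h2
  rw [add_zero] at h3
  refine h3.congr fun p => ?_
  simp only [heatTailD, heatTail]
  ring

/-! ### Exponential growth -/

/-- `f` has at most exponential growth in `x` on the strip `0 < t ≤ T`. -/
def HasExpGrowth (T : ℝ) (f : ℝ → ℝ → ℝ) : Prop :=
  ∃ C a : ℝ, ∀ x ≥ 0, ∀ t ∈ Ioc 0 T, |f x t| ≤ C * Real.exp (a * x)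

theorem mul_exp_add_le {C₁ C₂ a₁ a₂ x : ℝ} (hx : 0 ≤ x) :
    C₁ * Real.exp (a₁ * x) + C₂ * Real.exp (a₂ * x)
      ≤ (|C₁| + |C₂|) * Real.exp (max a₁ a₂ * x) := by
  have h1 : C₁ * Real.exp (a₁ * x) ≤ |C₁| * Real.exp (max a₁ a₂ * x) :=
    mul_le_mul (le_abs_self _)
      (Real.exp_le_exp.2 (mul_le_mul_of_nonneg_right (le_max_left _ _) hx))
      (Real.exp_pos _).le (abs_nonneg _)
  have h2 : C₂ * Real.exp (a₂ * x) ≤ |C₂| * Real.exp (max a₁ a₂ * x) :=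
    mul_le_mul (le_abs_self _)
      (Real.exp_le_exp.2 (mul_le_mul_of_nonneg_right (le_max_right _ _) hx))
      (Real.exp_pos _).le (abs_nonneg _)
  linarith

namespace HasExpGrowth

variable {T : ℝ} {f g : ℝ → ℝ → ℝ}

theorem add (hf : HasExpGrowth T f) (hg : HasExpGrowth T g) :
    HasExpGrowth T (fun x t => f x t + g x t) := by
  obtain ⟨C, a, h⟩ := hf
  obtain ⟨D, b, k⟩ := hg
  exact ⟨|C| + |D|, max a b, fun x hx t ht =>
    (abs_add_le _ _).trans ((add_le_add (h x hx t ht) (k x hx t ht)).trans (mul_exp_add_le hx))⟩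

theorem const_mul (c : ℝ) (hf : HasExpGrowth T f) : HasExpGrowth T (fun x t => c * f x t) := by
  obtain ⟨C, a, h⟩ := hf
  refine ⟨|c| * C, a, fun x hx t ht => ?_⟩
  rw [abs_mul, mul_assoc]
  exact mul_le_mul_of_nonneg_left (h x hx t ht) (abs_nonneg _)

theorem sub (hf : HasExpGrowth T f) (hg : HasExpGrowth T g) :
    HasExpGrowth T (fun x t => f x t - g x t) := by
  have := hf.add (hg.const_mul (-1))
  simpa only [neg_one_mul, ← sub_eq_add_neg] using this

theorem exp_sub {ε : ℝ} (hε : 0 < ε) (T μ : ℝ) :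
    HasExpGrowth T (fun x t => Real.exp (ε * μ ^ 2 * t - μ * x)) := by
  refine ⟨Real.exp (ε * μ ^ 2 * T), -μ, fun x _ t ht => ?_⟩
  rw [abs_of_pos (Real.exp_pos _), ← Real.exp_add, Real.exp_le_exp]
  have := mul_le_mul_of_nonneg_left ht.2 (show 0 ≤ ε * μ ^ 2 by positivity)
  linarith

end HasExpGrowth

theorem heatTail_nonneg (ε ν x t : ℝ) : 0 ≤ heatTail ε ν x t :=
  mul_nonneg (Real.exp_pos _).le (gaussCdf_pos _).le

theorem heatTail_le_exp (ε ν x t : ℝ) : heatTail ε ν x t ≤ Real.exp (ε * ν ^ 2 * t - ν * x) :=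
  mul_le_of_le_one_right (Real.exp_pos _).le (gaussCdf_lt_one _).le

theorem hasExpGrowth_heatTail {ε : ℝ} (hε : 0 < ε) (T ν : ℝ) :
    HasExpGrowth T (heatTail ε ν) := by
  obtain ⟨C, a, h⟩ := HasExpGrowth.exp_sub hε T ν
  refine ⟨C, a, fun x hx t ht => le_trans ?_ (h x hx t ht)⟩
  rw [abs_of_nonneg (heatTail_nonneg _ _ _ _)]
  exact (heatTail_le_exp _ _ _ _).trans (le_abs_self _)

theorem hasExpGrowth_heatTailD {ε : ℝ} (hε : 0 < ε) (T ν : ℝ) :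
    HasExpGrowth T (heatTailD ε ν) := by
  have h1 : HasExpGrowth T (fun x t => (2 * ε * ν * t - x) * heatTail ε ν x t) := by
    obtain ⟨C, a, h⟩ := hasExpGrowth_heatTail hε T ν
    refine ⟨(2 * ε * |ν| * T + 1) * C, a + 1, fun x hx t ht => ?_⟩
    have hT : 0 ≤ T := ht.1.le.trans ht.2
    have e : (2 * ε * |ν| * T + 1) * C * Real.exp ((a + 1) * x)
        = ((2 * ε * |ν| * T + 1) * Real.exp x) * (C * Real.exp (a * x)) := by
      rw [add_mul a, one_mul, Real.exp_add]
      ring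
    rw [abs_mul, e]
    refine mul_le_mul ?_ (h x hx t ht) (abs_nonneg _) (by positivity)
    have hb : |2 * ε * ν * t| ≤ 2 * ε * |ν| * T := by
      rw [abs_mul, abs_mul, abs_of_pos ht.1, abs_of_pos (by positivity : 0 < 2 * ε)]
      exact mul_le_mul_of_nonneg_left ht.2 (by positivity)
    have hx1 : x ≤ Real.exp x := by linarith [Real.add_one_le_exp x]
    have hx2 : 1 ≤ Real.exp x := Real.one_le_exp hx
    have h3 : |2 * ε * ν * t - x| ≤ |2 * ε * ν * t| + |x| := abs_sub _ _
    rw [abs_of_nonneg hx] at h3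
    have : 2 * ε * |ν| * T * 1 ≤ 2 * ε * |ν| * T * Real.exp x :=
      mul_le_mul_of_nonneg_left hx2 (by positivity)
    linarith
  have h2 : HasExpGrowth T (fun x t => 2 * ε * t * heatKer ε x t) := by
    refine ⟨√(4 * ε * T), 0, fun x _ t ht => ?_⟩
    refine (abs_two_mul_mul_heatKer_le hε ht.1 x).trans ?_
    rw [zero_mul, Real.exp_zero, mul_one]
    exact Real.sqrt_le_sqrt (mul_le_mul_of_nonneg_left ht.2 (by positivity))
  exact h1.add h2

/-! ### The explicit solution of the Robin problem -/

/-- The difference quotient of `heatTail` between the parameters `l` and `-m`. -/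
noncomputable def heatSlope (ε l m : ℝ) : ℝ → ℝ → ℝ :=
  if l + m = 0 then heatTailD ε l
  else fun x t => (l + m)⁻¹ * (heatTail ε l x t - heatTail ε (-m) x t)

/-- The solution, at positive times, of `w_t = ε w_xx` on the half line with `w_x + l w = 0` at
`x = 0` and initial value `exp (-m x)`. -/
noncomputable def robinFormula (ε l m x t : ℝ) : ℝ :=
  Real.exp (ε * m ^ 2 * t - m * x) + (heatTail ε l x t - heatTail ε m x t)
    + (l - m) * heatSlope ε l m x t

/-- `robinFormula`, extended to `t = 0` by the initial value. -/
noncomputable def robinSolution (ε l m x t : ℝ) : ℝ :=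
  if t = 0 then Real.exp (-(m * x)) else robinFormula ε l m x t

theorem robinSolution_of_pos {ε l m x t : ℝ} (ht : 0 < t) :
    robinSolution ε l m x t = robinFormula ε l m x t := if_neg ht.ne'

theorem isCaloric_heatSlope {ε : ℝ} (hε : 0 < ε) (l m : ℝ) : IsCaloric ε (heatSlope ε l m) := by
  unfold heatSlope
  split_ifs
  · exact isCaloric_heatTailD hε l
  · exact ((isCaloric_heatTail hε l).sub (isCaloric_heatTail hε (-m))).const_mul _

/-- The heat kernels cancel in the difference quotient, so the slope solves `S_x + l S = -H`, with
`H` the tail of parameter `-m`. When `l + m = 0` the derivative in `ν` obeys the same identity. -/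
theorem hasDerivAt_heatSlope_x {ε : ℝ} (hε : 0 < ε) (l m : ℝ) {t : ℝ} (ht : 0 < t) (x : ℝ) :
    HasDerivAt (fun x => heatSlope ε l m x t)
      (-l * heatSlope ε l m x t - heatTail ε (-m) x t) x := by
  unfold heatSlope
  split_ifs with h
  · have : -m = l := by linarith
    rw [this]
    exact hasDerivAt_heatTailD_x hε ht l x
  · refine (((hasDerivAt_heatTail_x hε ht l x).fun_sub
      (hasDerivAt_heatTail_x hε ht (-m) x)).const_mul (l + m)⁻¹).congr_deriv ?_
    field_simp
    ring

theorem tendsto_heatSlope_initialFilter {ε : ℝ} (hε : 0 < ε) (l m : ℝ) {x₀ : ℝ} (hx₀ : 0 ≤ x₀) :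
    Tendsto (fun p : ℝ × ℝ => heatSlope ε l m p.1 p.2) (initialFilter x₀) (𝓝 0) := by
  unfold heatSlope
  split_ifs
  · exact tendsto_heatTailD_initialFilter hε hx₀ l
  · simpa using (tendsto_heatTail_sub_initialFilter hε hx₀ l (-m)).const_mul (l + m)⁻¹

theorem hasExpGrowth_heatSlope {ε : ℝ} (hε : 0 < ε) (l m T : ℝ) : HasExpGrowth T (heatSlope ε l m) := by
  unfold heatSlope
  split_ifs
  · exact hasExpGrowth_heatTailD hε T l
  · exact ((hasExpGrowth_heatTail hε T l).sub (hasExpGrowth_heatTail hε T (-m))).const_mul _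

theorem isCaloric_robinFormula {ε : ℝ} (hε : 0 < ε) (l m : ℝ) : IsCaloric ε (robinFormula ε l m) :=
  ((IsCaloric.exp_sub ε m).add ((isCaloric_heatTail hε l).sub (isCaloric_heatTail hε m))).add
    ((isCaloric_heatSlope hε l m).const_mul (l - m))

theorem hasExpGrowth_robinFormula {ε : ℝ} (hε : 0 < ε) (l m T : ℝ) : HasExpGrowth T (robinFormula ε l m) :=
  ((HasExpGrowth.exp_sub hε T m).add
    ((hasExpGrowth_heatTail hε T l).sub (hasExpGrowth_heatTail hε T m))).add
    ((hasExpGrowth_heatSlope hε l m T).const_mul (l - m))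

theorem tendsto_robinFormula_initialFilter {ε : ℝ} (hε : 0 < ε) (l m : ℝ) {x₀ : ℝ} (hx₀ : 0 ≤ x₀) :
    Tendsto (fun p : ℝ × ℝ => robinFormula ε l m p.1 p.2) (initialFilter x₀)
      (𝓝 (Real.exp (-(m * x₀)))) := by
  have h : Continuous fun p : ℝ × ℝ => Real.exp (ε * m ^ 2 * p.2 - m * p.1) := by fun_prop
  have h1 := (h.tendsto (x₀, 0)).mono_left (nhdsWithin_le_nhds (s := Ici 0 ×ˢ Ioi 0))
  have h2 := (h1.add (tendsto_heatTail_sub_initialFilter hε hx₀ l m)).add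
    ((tendsto_heatSlope_initialFilter hε l m hx₀).const_mul (l - m))
  simp only [mul_zero, add_zero, zero_sub] at h2
  exact h2

/-- The defect `w_x + l w` is `l - m` times the heat evolution of the odd reflection of `exp (-m
x)`: the exponential minus the tail of parameter `m` is the contribution of the half line, and the
tail of parameter `-m` is that of its mirror image. -/
theorem hasDerivAt_robinFormula_x {ε : ℝ} (hε : 0 < ε) (l m : ℝ) {t : ℝ} (ht : 0 < t) (x : ℝ) :
    HasDerivAt (fun x => robinFormula ε l m x t)
      (-l * robinFormula ε l m x t + (l - m) * (Real.exp (ε * m ^ 2 * t - m * x)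
        - heatTail ε m x t - heatTail ε (-m) x t)) x := by
  have h1 := (((hasDerivAt_id x).const_mul m).const_sub (ε * m ^ 2 * t)).exp
  have h := (h1.fun_add ((hasDerivAt_heatTail_x hε ht l x).fun_sub
    (hasDerivAt_heatTail_x hε ht m x))).fun_add
    ((hasDerivAt_heatSlope_x hε l m ht x).const_mul (l - m))
  refine h.congr_deriv ?_
  simp only [robinFormula, id]
  ring

/-- The odd reflection vanishes at `x = 0`, by `Φ(z) + Φ(-z) = 1`; this is the Robin condition. -/
theorem heatTail_add_heatTail_neg (ε m t : ℝ) :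
    Real.exp (ε * m ^ 2 * t - m * 0) - heatTail ε m 0 t - heatTail ε (-m) 0 t = 0 := by
  have h := gaussCdf_add_neg ((2 * ε * m * t - 0) / √(4 * ε * t))
  have e : (2 * ε * -m * t - 0) / √(4 * ε * t) = -((2 * ε * m * t - 0) / √(4 * ε * t)) := by ring
  have e2 : ε * (-m) ^ 2 * t - -m * 0 = ε * m ^ 2 * t - m * 0 := by ring
  simp only [heatTail]
  rw [e, e2]
  linear_combination -Real.exp (ε * m ^ 2 * t - m * 0) * h

theorem isHopfColeSolution_robinSolution {ε : ℝ} (hε : 0 < ε) (l m : ℝ) :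
    IsHopfColeSolution ε (2 * ε * m) (2 * ε * l) (robinSolution ε l m) := by
  have hcal := isCaloric_robinFormula hε l m
  have heq : EqOn (fun p : ℝ × ℝ => robinSolution ε l m p.1 p.2)
      (fun p => robinFormula ε l m p.1 p.2) (univ ×ˢ Ioi 0) := fun p hp =>
    robinSolution_of_pos hp.2
  have hsub : quarterPlane ⊆ univ ×ˢ Ioi 0 := prod_mono (subset_univ _) le_rfl
  refine ⟨?_, ?_, ?_, ?_, ?_, ?_⟩
  · rintro ⟨x, t⟩ ⟨hx, ht⟩
    simp only [mem_Ici] at hx ht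
    rcases ht.eq_or_lt with rfl | ht
    -- On `t = 0` continuity is checked separately from positive times and along the axis.
    · have hu : (Ici 0 ×ˢ Ici 0 : Set (ℝ × ℝ)) = Ici 0 ×ˢ Ioi 0 ∪ Ici 0 ×ˢ {0} := by
        rw [← prod_union, ← Ioi_insert, union_singleton]
      rw [hu]
      refine ContinuousWithinAt.union ?_ ?_
      · have h := tendsto_robinFormula_initialFilter hε l m hx
        unfold ContinuousWithinAt
        simp only [robinSolution, if_true]
        refine h.congr' ?_
        filter_upwards [self_mem_nhdsWithin] with p hp
        exact (if_neg (ne_of_gt hp.2)).symm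
      · have h : Continuous fun p : ℝ × ℝ => Real.exp (-(m * p.1)) := by fun_prop
        refine (h.continuousWithinAt (s := Ici 0 ×ˢ {0}) (x := (x, 0))).congr ?_ ?_
        · rintro p ⟨_, hp⟩
          exact if_pos hp
        · exact if_pos rfl
    · have ho : (univ ×ˢ Ioi 0 : Set (ℝ × ℝ)) ∈ 𝓝 (x, t) :=
        (isOpen_univ.prod isOpen_Ioi).mem_nhds ⟨mem_univ _, ht⟩
      exact ((hcal.contDiffOn.continuousOn.congr heq).continuousAt ho).continuousWithinAt
  · exact (hcal.contDiffOn.congr heq).mono hsub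
  · intro x _ t ht
    have e1 : (fun s => robinSolution ε l m x s) =ᶠ[𝓝 t] fun s => robinFormula ε l m x s := by
      filter_upwards [lt_mem_nhds ht] with s hs
      exact robinSolution_of_pos hs
    have e2 : (fun y => robinSolution ε l m y t) = fun y => robinFormula ε l m y t :=
      funext fun y => robinSolution_of_pos ht
    rw [e1.deriv_eq, e2]
    exact hcal.deriv_eq x ht
  · intro x _
    simp only [robinSolution, if_true]
    congr 1
    field_simp
  · intro t ht
    have e2 : (fun y => robinSolution ε l m y t) = fun y => robinFormula ε l m y t :=
      funext fun y => robinSolution_of_pos ht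
    refine ⟨_, e2 ▸ (hasDerivAt_robinFormula_x hε l m ht 0).hasDerivWithinAt, ?_⟩
    rw [heatTail_add_heatTail_neg, robinSolution_of_pos ht]
    ring
  · intro T _
    obtain ⟨C, a, h⟩ := hasExpGrowth_robinFormula hε l m T
    refine ⟨|C| + 1, max a (-m), fun x hx t ht => ?_⟩
    have hle : ∀ y, y = C * Real.exp (a * x) ∨ y = 1 * Real.exp (-m * x) →
        y ≤ (|C| + 1) * Real.exp (max a (-m) * x) := by
      have h0 := mul_exp_add_le (C₁ := C) (C₂ := 0) (a₁ := a) (a₂ := -m) hx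
      have h1 := mul_exp_add_le (C₁ := 0) (C₂ := 1) (a₁ := a) (a₂ := -m) hx
      have he := Real.exp_pos (max a (-m) * x)
      have hc : 0 ≤ |C| * Real.exp (max a (-m) * x) := by positivity
      simp only [abs_zero, abs_one, zero_mul, add_zero, zero_add, one_mul] at h0 h1
      rintro y (rfl | rfl) <;> linarith
    rcases ht.1.eq_or_lt with h0 | h0
    · rw [← h0, robinSolution, if_pos rfl, abs_of_pos (Real.exp_pos _)]
      exact hle _ (Or.inr (by rw [one_mul, neg_mul]))
    · rw [robinSolution_of_pos h0]
      exact (h x hx t ⟨h0, ht.2⟩).trans (hle _ (Or.inl rfl))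

/-! ### Uniqueness for the Robin problem -/

/-- If the second derivative were positive, the point would also be a local minimum, so the function
would be locally constant and its second derivative zero. -/
theorem IsLocalMax.deriv_deriv_nonpos {f : ℝ → ℝ} {x : ℝ} (h : IsLocalMax f x)
    (hc : ContinuousAt f x) : deriv (deriv f) x ≤ 0 := by
  by_contra! hpos
  have hmin := isLocalMin_of_deriv_deriv_pos hpos h.deriv_eq_zero hc
  have he : f =ᶠ[𝓝 x] fun _ => f x := by
    filter_upwards [h, hmin] with y h1 h2
    exact le_antisymm h1 h2
  rw [he.deriv.deriv_eq] at hpos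
  simp at hpos

theorem HasDerivWithinAt.nonpos_of_isMaxOn {f : ℝ → ℝ} {d x y : ℝ} (hxy : x < y)
    (hf : HasDerivWithinAt f d (Ici x) x) (h : ∀ z ∈ Ioo x y, f z ≤ f x) : d ≤ 0 := by
  have h1 := (hasDerivWithinAt_iff_tendsto_slope' self_notMem_Ioi).1 hf.Ioi_of_Ici
  refine le_of_tendsto h1 ?_
  filter_upwards [Ioo_mem_nhdsGT hxy] with z hz
  rw [slope_def_field]
  exact div_nonpos_of_nonpos_of_nonneg (by linarith [h z hz]) (by linarith [hz.1])

theorem HasDerivWithinAt.nonneg_of_isMaxOn {f : ℝ → ℝ} {d x y : ℝ} (hyx : y < x)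
    (hf : HasDerivWithinAt f d (Iic x) x) (h : ∀ z ∈ Ioo y x, f z ≤ f x) : 0 ≤ d := by
  have h1 := (hasDerivWithinAt_iff_tendsto_slope' self_notMem_Iio).1
    (hf.mono Iio_subset_Iic_self)
  refine ge_of_tendsto h1 ?_
  filter_upwards [Ioo_mem_nhdsLT hyx] with z hz
  rw [slope_def_field]
  exact div_nonneg_of_nonpos (by linarith [h z hz]) (by linarith [hz.2])

/-- Weight with `β' (0) + l β (0) < 0`, which grows faster than `exp (A x)`. -/
theorem exists_robin_weight (A l : ℝ) : ∃ N L R : ℝ, 0 < L ∧ A + 1 ≤ N ∧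
    N - L * R + l * (1 + L) < 0 := by
  -- Here `L = N + |l| + 1` and `R = |l| + 1`, so `L (l - R) ≤ -L` and the expression is at most `N
  -- + |l| - L = -1`.
  refine ⟨|A| + 1, |A| + 1 + |l| + 1, |l| + 1, by positivity, by linarith [le_abs_self A], ?_⟩
  have h1 := le_abs_self l
  have h2 := abs_nonneg l
  have h3 := abs_nonneg A
  nlinarith

theorem isOpen_quarterPlane : IsOpen quarterPlane := isOpen_Ioi.prod isOpen_Ioi

namespace IsHopfColeSolution

variable {ε v0 vb : ℝ} {w w' : ℝ → ℝ → ℝ}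

theorem contDiffAt_x (h : IsHopfColeSolution ε v0 vb w) {x t : ℝ} (hx : 0 < x) (ht : 0 < t) :
    ContDiffAt ℝ 2 (fun x => w x t) x :=
  (h.contDiffOn.contDiffAt (isOpen_quarterPlane.mem_nhds (x := (x, t)) ⟨hx, ht⟩)).comp x
    (contDiffAt_id.prodMk contDiffAt_const)

theorem differentiableAt_t (h : IsHopfColeSolution ε v0 vb w) {x t : ℝ} (hx : 0 < x)
    (ht : 0 < t) : DifferentiableAt ℝ (fun t => w x t) t :=
  ((h.contDiffOn.contDiffAt (isOpen_quarterPlane.mem_nhds (x := (x, t)) ⟨hx, ht⟩)).comp t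
    (contDiffAt_const.prodMk contDiffAt_id)).differentiableAt two_ne_zero

/-- Maximum principle for `(w - w') / B` with the barrier `B = exp (K t) (exp (N x) + L exp (-R
x))`. The growth in `x` excludes a maximum far out, `B_x + l B < 0` at `x = 0` excludes the
boundary, and `B_t > ε B_xx` excludes the interior. -/
theorem le_of_isHopfColeSolution (hε : 0 < ε) (h : IsHopfColeSolution ε v0 vb w)
    (h' : IsHopfColeSolution ε v0 vb w') {x₁ t₁ : ℝ} (hx₁ : 0 ≤ x₁) (ht₁ : 0 ≤ t₁) :
    w x₁ t₁ ≤ w' x₁ t₁ := by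
  by_contra! hlt
  have ht1 : 0 < t₁ := by
    rcases ht₁.eq_or_lt with rfl | ht
    · rw [h.initial x₁ hx₁, h'.initial x₁ hx₁] at hlt
      exact absurd hlt (lt_irrefl _)
    · exact ht
  obtain ⟨C₁, A₁, hg₁⟩ := h.growth t₁ ht1
  obtain ⟨C₂, A₂, hg₂⟩ := h'.growth t₁ ht1
  set A := max A₁ A₂ with hA
  set C := |C₁| + |C₂| with hC
  have hC0 : 0 ≤ C := by positivity
  have hz : ∀ x ≥ 0, ∀ t ∈ Icc 0 t₁, w x t - w' x t ≤ C * Real.exp (A * x) := by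
    intro x hx t ht
    have k1 := (abs_le.1 (hg₁ x hx t ht)).2
    have k2 := (abs_le.1 (hg₂ x hx t ht)).1
    have k3 := mul_exp_add_le (C₁ := C₁) (C₂ := C₂) (a₁ := A₁) (a₂ := A₂) hx
    linarith
  obtain ⟨N, L, R, hL, hN, hR⟩ := exists_robin_weight A (vb / (2 * ε))
  -- `B_xx` is at most `(N² + R²) B`, so this `K` makes `B` a strict supersolution.
  set K := ε * (N ^ 2 + R ^ 2) + 1 with hK
  have hK0 : 0 < K := by positivity
  set B : ℝ → ℝ → ℝ := fun x t =>
    Real.exp (K * t) * (Real.exp (N * x) + L * Real.exp (-R * x)) with hB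
  have hBpos : ∀ x t, 0 < B x t := fun x t => by positivity
  have hBcont : Continuous fun p : ℝ × ℝ => B p.1 p.2 := by fun_prop
  have hq : ContinuousOn (fun p : ℝ × ℝ => (w p.1 p.2 - w' p.1 p.2) / B p.1 p.2)
      (Ici 0 ×ˢ Ici 0) :=
    (h.continuousOn.sub h'.continuousOn).div hBcont.continuousOn fun p _ => (hBpos _ _).ne'
  have hdecay : ∀ x ≥ 0, ∀ t ∈ Icc 0 t₁, (w x t - w' x t) / B x t ≤ C * Real.exp (-x) := by
    intro x hx t ht
    rw [div_le_iff₀ (hBpos x t)]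
    refine (hz x hx t ht).trans ?_
    rw [mul_assoc]
    refine mul_le_mul_of_nonneg_left ?_ hC0
    have e1 : 1 ≤ Real.exp (K * t) := Real.one_le_exp (mul_nonneg hK0.le ht.1)
    have e2 : Real.exp (A * x) ≤ Real.exp (-x) * Real.exp (N * x) := by
      rw [← Real.exp_add, Real.exp_le_exp]
      nlinarith
    have e3 : Real.exp (N * x) ≤ B x t := by
      have : 0 < L * Real.exp (-R * x) := by positivity
      have e4 := Real.exp_pos (N * x)
      simp only [hB]
      nlinarith
    exact e2.trans (mul_le_mul_of_nonneg_left e3 (Real.exp_pos _).le)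
  set q₁ := (w x₁ t₁ - w' x₁ t₁) / B x₁ t₁ with hq₁
  have hq₁pos : 0 < q₁ := div_pos (by linarith) (hBpos _ _)
  -- Beyond `X` the quotient is below its value at `(x₁, t₁)`, so the maximum over the compact
  -- rectangle is not attained at `x = X`.
  obtain ⟨X, hX, hX1⟩ : ∃ X, C * Real.exp (-X) < q₁ ∧ x₁ < X := by
    have := (Real.tendsto_exp_neg_atTop_nhds_zero.const_mul C)
    rw [mul_zero] at this
    exact ((this.eventually_lt_const hq₁pos).and (eventually_gt_atTop x₁)).exists
  have hcomp : IsCompact (Icc 0 X ×ˢ Icc 0 t₁ : Set (ℝ × ℝ)) := isCompact_Icc.prod isCompact_Icc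
  obtain ⟨⟨x₀, t₀⟩, ⟨⟨hx0, hxX⟩, ht0, htt⟩, hmax⟩ := hcomp.exists_isMaxOn
    ⟨(x₁, t₁), ⟨hx₁, hX1.le⟩, ht₁, le_rfl⟩
    (hq.mono (prod_mono Icc_subset_Ici_self Icc_subset_Ici_self))
  simp only at hx0 hxX ht0 htt
  set M := (w x₀ t₀ - w' x₀ t₀) / B x₀ t₀ with hM
  have hM1 : q₁ ≤ M := hmax (show ((x₁, t₁) : ℝ × ℝ) ∈ _ from ⟨⟨hx₁, hX1.le⟩, ht₁, le_rfl⟩)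
  have hMpos : 0 < M := hq₁pos.trans_le hM1
  have hMB : w x₀ t₀ - w' x₀ t₀ = M * B x₀ t₀ := (div_mul_cancel₀ _ (hBpos _ _).ne').symm
  have hle : ∀ x ∈ Icc 0 X, ∀ t ∈ Icc 0 t₁,
      w x t - w' x t - M * B x t ≤ w x₀ t₀ - w' x₀ t₀ - M * B x₀ t₀ := by
    intro x hx t ht
    have : (w x t - w' x t) / B x t ≤ M := hmax (show ((x, t) : ℝ × ℝ) ∈ _ from ⟨hx, ht⟩)
    rw [div_le_iff₀ (hBpos _ _)] at this
    rw [hMB]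
    linarith
  have hx0X : x₀ < X := by
    refine lt_of_le_of_ne hxX fun he => ?_
    have := hdecay x₀ hx0 t₀ ⟨ht0, htt⟩
    rw [he] at this
    rw [hM, he] at hM1
    linarith
  have ht0pos : 0 < t₀ := by
    refine lt_of_le_of_ne ht0 fun he => ?_
    rw [← he, h.initial x₀ hx0, h'.initial x₀ hx0, sub_self] at hMB
    have := mul_pos hMpos (hBpos x₀ 0)
    linarith
  have hE := Real.exp_pos (K * t₀)
  have hBx : ∀ x, HasDerivAt (fun x => B x t₀)
      (Real.exp (K * t₀) * (N * Real.exp (N * x) - L * R * Real.exp (-R * x))) x := by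
    intro x
    have k := ((((hasDerivAt_id x).const_mul N).exp).fun_add
      (((hasDerivAt_id x).const_mul (-R)).exp.const_mul L)).const_mul (Real.exp (K * t₀))
    refine k.congr_deriv ?_
    simp only [id]
    ring
  rcases hx0.eq_or_lt with rfl | hx0pos
  · obtain ⟨d, hd, hd0⟩ := h.boundary t₀ ht0pos
    obtain ⟨d', hd', hd0'⟩ := h'.boundary t₀ ht0pos
    -- At `x = 0` the one-sided derivative of `w - w' - M B` is nonpositive, whereas the Robin
    -- conditions make it `-M (B_x + l B) > 0`.
    have hder := (hd.sub hd').sub ((hBx 0).const_mul M).hasDerivWithinAt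
    have hn := hder.nonpos_of_isMaxOn (y := X) hx0X fun z hz =>
      hle z ⟨hz.1.le, hz.2.le⟩ t₀ ⟨ht0, htt⟩
    simp only [hB, mul_zero, Real.exp_zero, mul_one] at hn hMB
    have hw : d - d' = -(vb / (2 * ε)) * (w 0 t₀ - w' 0 t₀) := by
      field_simp
      linarith
    rw [hw, hMB] at hn
    have : M * Real.exp (K * t₀) * (N - L * R + vb / (2 * ε) * (1 + L)) < 0 :=
      mul_neg_of_pos_of_neg (by positivity) hR
    nlinarith
  · have hBxx : deriv (deriv fun x => B x t₀) x₀ = Real.exp (K * t₀)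
        * (N ^ 2 * Real.exp (N * x₀) + L * R ^ 2 * Real.exp (-R * x₀)) := by
      rw [show deriv (fun x => B x t₀) = _ from funext fun x => (hBx x).deriv]
      have k := ((((hasDerivAt_id x₀).const_mul N).exp.const_mul N).fun_sub
        (((hasDerivAt_id x₀).const_mul (-R)).exp.const_mul (L * R))).const_mul (Real.exp (K * t₀))
      refine k.deriv.trans ?_
      simp only [id]
      ring
    have c1 := h.contDiffAt_x hx0pos ht0pos
    have c2 := h'.contDiffAt_x hx0pos ht0pos
    have c3 : ContDiffAt ℝ 2 (fun x => M * B x t₀) x₀ := by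
      simp only [hB]
      fun_prop
    have hdd : ∀ f : ℝ → ℝ, deriv (deriv f) x₀ = iteratedDeriv 2 f x₀ := fun f => by
      rw [iteratedDeriv_succ, iteratedDeriv_one]
    have hlm : IsLocalMax (fun x => w x t₀ - w' x t₀ - M * B x t₀) x₀ := by
      filter_upwards [Ioo_mem_nhds hx0pos hx0X] with x hx
      exact hle x ⟨hx.1.le, hx.2.le⟩ t₀ ⟨ht0, htt⟩
    have h2 := hlm.deriv_deriv_nonpos ((c1.sub c2).sub c3).continuousAt
    rw [hdd, iteratedDeriv_fun_sub (by exact_mod_cast c1.sub c2) (by exact_mod_cast c3),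
      iteratedDeriv_fun_sub (by exact_mod_cast c1) (by exact_mod_cast c2),
      iteratedDeriv_const_mul_field, ← hdd, ← hdd, ← hdd, hBxx] at h2
    have d1 := (h.differentiableAt_t hx0pos ht0pos).hasDerivAt
    have d2 := (h'.differentiableAt_t hx0pos ht0pos).hasDerivAt
    have d3 : HasDerivAt (fun t => B x₀ t) (K * B x₀ t₀) t₀ := by
      have k := ((hasDerivAt_id t₀).const_mul K).exp.mul_const
        (Real.exp (N * x₀) + L * Real.exp (-R * x₀))
      refine k.congr_deriv ?_
      simp only [id, hB]
      ring
    -- Only the derivative from the left is used, because `t₀ = t₁` is possible.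
    have h3 := ((d1.fun_sub d2).fun_sub (d3.const_mul M)).hasDerivWithinAt.nonneg_of_isMaxOn
      (y := 0) ht0pos fun t ht => hle x₀ ⟨hx0, hxX⟩ t ⟨ht.1.le, ht.2.le.trans htt⟩
    rw [h.heat x₀ hx0pos t₀ ht0pos, h'.heat x₀ hx0pos t₀ ht0pos] at h3
    have h4 := mul_le_mul_of_nonneg_left h2 hε.le
    have e1 := Real.exp_pos (N * x₀)
    have e2 := mul_pos hL (Real.exp_pos (-R * x₀))
    have h5 : 0 < M * Real.exp (K * t₀) * (ε * (R ^ 2 * Real.exp (N * x₀)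
        + N ^ 2 * (L * Real.exp (-R * x₀))) + (Real.exp (N * x₀) + L * Real.exp (-R * x₀))) := by
      positivity
    simp only [hB, hK] at h3 h4 h5
    linarith

theorem eq_of_isHopfColeSolution (hε : 0 < ε) (h : IsHopfColeSolution ε v0 vb w)
    (h' : IsHopfColeSolution ε v0 vb w') {x t : ℝ} (hx : 0 ≤ x) (ht : 0 ≤ t) :
    w x t = w' x t :=
  le_antisymm (h.le_of_isHopfColeSolution hε h' hx ht) (h'.le_of_isHopfColeSolution hε h hx ht)

end IsHopfColeSolution

/-! ### The viscous velocity in terms of the Mills function -/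

/-- The difference quotient of `θ ↦ mills ((θ t - x) τ)` between `b` and `-a`. -/
noncomputable def millsSlope (a b x t τ : ℝ) : ℝ :=
  if a + b = 0 then t * τ * millsD ((b * t - x) * τ)
  else (mills ((b * t - x) * τ) - mills ((-x - a * t) * τ)) / (a + b)

/-- The explicit solution of the Robin problem divided by `exp (-x² τ²)`, where `4 ε t τ² = 1`. -/
noncomputable def robinProfile (a b x t τ : ℝ) : ℝ :=
  mills ((x - a * t) * τ) + mills ((b * t - x) * τ) + (b - a) * millsSlope a b x t τ

/-- The solution of the viscous Burgers equation on the half line, where `4 ε t τ² = 1`. -/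
noncomputable def burgersProfile (a b x t τ : ℝ) : ℝ :=
  b + (a - b) * ((mills ((x - a * t) * τ) - mills ((-x - a * t) * τ)) / robinProfile a b x t τ)

theorem exp_mul_gaussCdf {ε t : ℝ} (hε : 0 < ε) (ht : 0 < t) (θ x : ℝ) :
    Real.exp (ε * (θ / (2 * ε)) ^ 2 * t - θ / (2 * ε) * x)
      = Real.exp (-x ^ 2 / (4 * ε * t)) * Real.exp (((θ * t - x) * (√(4 * ε * t))⁻¹) ^ 2) := by
  rw [← Real.exp_add, mul_pow, inv_pow, Real.sq_sqrt (by positivity)]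
  congr 1
  field_simp
  ring

theorem heatTail_eq_mills {ε t : ℝ} (hε : 0 < ε) (ht : 0 < t) (θ x : ℝ) :
    heatTail ε (θ / (2 * ε)) x t
      = Real.exp (-x ^ 2 / (4 * ε * t)) * mills ((θ * t - x) * (√(4 * ε * t))⁻¹) := by
  have e : 2 * ε * (θ / (2 * ε)) * t = θ * t := by field_simp
  rw [heatTail, mills, exp_mul_gaussCdf hε ht, e, div_eq_mul_inv (θ * t - x), mul_assoc]

theorem exp_sub_heatTail_eq_mills {ε t : ℝ} (hε : 0 < ε) (ht : 0 < t) (θ x : ℝ) :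
    Real.exp (ε * (θ / (2 * ε)) ^ 2 * t - θ / (2 * ε) * x) - heatTail ε (θ / (2 * ε)) x t
      = Real.exp (-x ^ 2 / (4 * ε * t)) * mills ((x - θ * t) * (√(4 * ε * t))⁻¹) := by
  have e : (x - θ * t) * (√(4 * ε * t))⁻¹ = -((θ * t - x) * (√(4 * ε * t))⁻¹) := by ring
  have h := gaussCdf_add_neg ((θ * t - x) * (√(4 * ε * t))⁻¹)
  rw [heatTail_eq_mills hε ht, exp_mul_gaussCdf hε ht, mills, mills, e, neg_sq]
  linear_combination -(Real.exp (-x ^ 2 / (4 * ε * t))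
    * Real.exp (((θ * t - x) * (√(4 * ε * t))⁻¹) ^ 2)) * h

theorem heatSlope_eq_millsSlope {ε t : ℝ} (hε : 0 < ε) (ht : 0 < t) (a b x : ℝ) :
    (b / (2 * ε) - a / (2 * ε)) * heatSlope ε (b / (2 * ε)) (a / (2 * ε)) x t
      = Real.exp (-x ^ 2 / (4 * ε * t)) * ((b - a) * millsSlope a b x t (√(4 * ε * t))⁻¹) := by
  have h4 : 0 < 4 * ε * t := by positivity
  have hs0 := Real.sqrt_pos.2 h4
  have hs := Real.sq_sqrt h4.le
  have hiff : b / (2 * ε) + a / (2 * ε) = 0 ↔ a + b = 0 := by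
    rw [← add_div, div_eq_zero_iff]
    constructor
    · rintro (h | h)
      · linarith
      · linarith
    · intro h
      left
      linarith
  unfold heatSlope millsSlope
  by_cases hab : a + b = 0
  · rw [if_pos (hiff.2 hab), if_pos hab, heatTailD, heatTail_eq_mills hε ht, heatKer, millsD]
    have e : 2 * ε * (b / (2 * ε)) * t = b * t := by field_simp
    rw [e]
    generalize mills ((b * t - x) * (√(4 * ε * t))⁻¹) = m
    generalize Real.exp (-x ^ 2 / (4 * ε * t)) = g
    have hp := sqrt_pi_pos
    generalize √(4 * ε * t) = s at hs hs0
    generalize √Real.pi = k at hp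
    field_simp
    linear_combination (b - a) * m * k * g * (b * t - x) * hs
  · rw [if_neg (mt hiff.1 hab), if_neg hab, ← neg_div, heatTail_eq_mills hε ht,
      heatTail_eq_mills hε ht, ← add_div, ← sub_div, add_comm b a]
    have e : -a * t - x = -x - a * t := by ring
    rw [e]
    field_simp

theorem robinFormula_eq {ε t : ℝ} (hε : 0 < ε) (ht : 0 < t) (a b x : ℝ) :
    robinFormula ε (b / (2 * ε)) (a / (2 * ε)) x t
      = Real.exp (-x ^ 2 / (4 * ε * t)) * robinProfile a b x t (√(4 * ε * t))⁻¹ := by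
  have h1 := exp_sub_heatTail_eq_mills hε ht a x
  have h2 := heatTail_eq_mills hε ht b x
  have h3 := heatSlope_eq_millsSlope hε ht a b x
  simp only [robinFormula, robinProfile]
  linear_combination h1 + h2 + h3

theorem hasDerivAt_mul_mills (x t τ θ : ℝ) :
    HasDerivAt (fun θ => θ * mills ((-x - θ * t) * τ))
      (mills ((-x - θ * t) * τ) - θ * (t * τ * millsD ((-x - θ * t) * τ))) θ := by
  have h1 := (((hasDerivAt_id θ).mul_const t).const_sub (-x)).mul_const τ
  have h2 := (hasDerivAt_id θ).fun_mul ((hasDerivAt_mills ((-x - θ * t) * τ)).comp θ h1)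
  refine h2.congr_deriv ?_
  simp only [id, Function.comp]
  ring

/-- `θ ↦ θ mills (-(x + θ t) τ)` is strictly increasing. -/
theorem deriv_mul_mills_pos {x τ : ℝ} (hx : 0 ≤ x) (hτ : 0 < τ) (t θ : ℝ) :
    0 < mills ((-x - θ * t) * τ) - θ * (t * τ * millsD ((-x - θ * t) * τ)) := by
  -- With `r = (-x - θt)τ` one has `-θtτ = r + xτ`, so the derivative is `(M + r M')(r) + xτ M'(r)`.
  have h1 := mills_add_mul_millsD_pos ((-x - θ * t) * τ)
  have h2 := mul_nonneg (mul_nonneg hx hτ.le) (millsD_pos ((-x - θ * t) * τ)).le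
  linarith

/-- The gap `D - (P - Q)` is `2 (aQ + bR)/(a + b)`, twice the difference quotient between `a` and
`-b` of the increasing function `θ ↦ θ M((-x - θt)τ)`; for `a + b = 0` it is twice the derivative.
-/
theorem sub_lt_robinProfile {x τ : ℝ} (hx : 0 ≤ x) (hτ : 0 < τ) (a b t : ℝ) :
    mills ((x - a * t) * τ) - mills ((-x - a * t) * τ) < robinProfile a b x t τ := by
  suffices h : 0 < mills ((-x - a * t) * τ) + mills ((b * t - x) * τ)
      + (b - a) * millsSlope a b x t τ by
    simp only [robinProfile]
    linarith
  unfold millsSlope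
  split_ifs with hab
  · obtain rfl : b = -a := by linarith
    have h := deriv_mul_mills_pos hx hτ t a
    have e : -a * t - x = -x - a * t := by ring
    rw [e]
    linarith
  · have hm : StrictMono fun θ => θ * mills ((-x - θ * t) * τ) :=
      strictMono_of_deriv_pos fun θ => by
        rw [(hasDerivAt_mul_mills x t τ θ).deriv]
        exact deriv_mul_mills_pos hx hτ t θ
    have hne : a ≠ -b := fun h => hab (by linarith)
    have hF : 0 < (a * mills ((-x - a * t) * τ) + b * mills ((b * t - x) * τ)) / (a + b) := by
      have e : -x - -b * t = b * t - x := by ring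
      rcases lt_or_gt_of_ne hne with h | h
      · have := hm h
        simp only [e] at this
        exact div_pos_of_neg_of_neg (by linarith) (by linarith)
      · have := hm h
        simp only [e] at this
        exact div_pos (by linarith) (by linarith)
    have e : mills ((-x - a * t) * τ) + mills ((b * t - x) * τ)
        + (b - a) * ((mills ((b * t - x) * τ) - mills ((-x - a * t) * τ)) / (a + b))
        = 2 * ((a * mills ((-x - a * t) * τ) + b * mills ((b * t - x) * τ)) / (a + b)) := by
      field_simp
      ring
    rw [e]
    linarith

theorem mills_sub_mills_nonneg {x τ : ℝ} (hx : 0 ≤ x) (hτ : 0 < τ) (a t : ℝ) :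
    0 ≤ mills ((x - a * t) * τ) - mills ((-x - a * t) * τ) :=
  sub_nonneg.2 (strictMono_mills.monotone (mul_le_mul_of_nonneg_right (by linarith) hτ.le))

theorem robinProfile_pos {x τ : ℝ} (hx : 0 ≤ x) (hτ : 0 < τ) (a b t : ℝ) :
    0 < robinProfile a b x t τ :=
  (mills_sub_mills_nonneg hx hτ a t).trans_lt (sub_lt_robinProfile hx hτ a b t)

/-- The quotient `(P - Q)/D` lies in `[0, 1]`. The bound does not depend on `ε` and serves as the
majorant in the passage to the limit. -/
theorem abs_burgersProfile_le {x τ : ℝ} (hx : 0 ≤ x) (hτ : 0 < τ) (a b t : ℝ) :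
    |burgersProfile a b x t τ| ≤ |b| + |a - b| := by
  have h1 := div_nonneg (mills_sub_mills_nonneg hx hτ a t) (robinProfile_pos hx hτ a b t).le
  have h2 := (div_le_one (robinProfile_pos hx hτ a b t)).2 (sub_lt_robinProfile hx hτ a b t).le
  refine (abs_add_le _ _).trans (add_le_add_right ?_ _)
  rw [abs_mul]
  refine mul_le_of_le_one_right (abs_nonneg _) ?_
  rwa [abs_of_nonneg h1]

theorem IsHopfColeSolution.eq_robinSolution {ε a b : ℝ} (hε : 0 < ε) {w : ℝ → ℝ → ℝ}
    (h : IsHopfColeSolution ε a b w) {x t : ℝ} (hx : 0 ≤ x) (ht : 0 ≤ t) :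
    w x t = robinSolution ε (b / (2 * ε)) (a / (2 * ε)) x t := by
  have h' := isHopfColeSolution_robinSolution hε (b / (2 * ε)) (a / (2 * ε))
  rw [mul_div_cancel₀ a (by positivity), mul_div_cancel₀ b (by positivity)] at h'
  exact h.eq_of_isHopfColeSolution hε h' hx ht

theorem IsHopfColeSolution.pos {ε a b : ℝ} (hε : 0 < ε) {w : ℝ → ℝ → ℝ}
    (h : IsHopfColeSolution ε a b w) {x t : ℝ} (hx : 0 ≤ x) (ht : 0 ≤ t) : 0 < w x t := by
  rw [h.eq_robinSolution hε hx ht]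
  rcases ht.eq_or_lt with rfl | ht
  · rw [robinSolution, if_pos rfl]
    exact Real.exp_pos _
  · rw [robinSolution_of_pos ht, robinFormula_eq hε ht]
    exact mul_pos (Real.exp_pos _)
      (robinProfile_pos hx (inv_pos.2 (Real.sqrt_pos.2 (by positivity))) a b t)

theorem viscousU_eq {ε a b : ℝ} (hε : 0 < ε) {w : ℝ → ℝ → ℝ} (h : IsHopfColeSolution ε a b w)
    {x t : ℝ} (hx : 0 < x) (ht : 0 < t) (k : ℝ) (j : ℕ) :
    viscousU k j ε w x t = burgersProfile a b x t (√(4 * ε * t))⁻¹ + signedSpeed k j := by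
  have he : (fun y => w y t) =ᶠ[𝓝 x] fun y => robinFormula ε (b / (2 * ε)) (a / (2 * ε)) y t := by
    filter_upwards [lt_mem_nhds hx] with y hy
    rw [h.eq_robinSolution hε hy.le ht.le, robinSolution_of_pos ht]
  have hτ : 0 < (√(4 * ε * t))⁻¹ := inv_pos.2 (Real.sqrt_pos.2 (by positivity))
  have hpos := robinProfile_pos hx.le hτ a b t
  have hg := Real.exp_pos (-x ^ 2 / (4 * ε * t))
  have h1 := exp_sub_heatTail_eq_mills hε ht a x
  have h2 := heatTail_eq_mills hε ht (-a) x
  have e : -a * t - x = -x - a * t := by ring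
  rw [e, neg_div (2 * ε) a] at h2
  rw [viscousU, he.deriv_eq, he.eq_of_nhds,
    (hasDerivAt_robinFormula_x hε (b / (2 * ε)) (a / (2 * ε)) ht x).deriv, ← neg_div, h1, h2,
    robinFormula_eq hε ht, burgersProfile]
  generalize (√(4 * ε * t))⁻¹ = τ at hpos
  generalize robinProfile a b x t τ = D at hpos
  generalize mills ((x - a * t) * τ) = P
  generalize mills ((-x - a * t) * τ) = Q
  generalize Real.exp (-x ^ 2 / (4 * ε * t)) = g at hg
  field_simp
  ring

/-! ### The vanishing viscosity limit -/

/-- `M(pτ)` is at least `exp (p²τ²)/2`, while `M(qτ)` is at most `exp (κ²τ²)` with `κ = max q 0 <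
p`. The cut at `0` is needed because for negative `q` the bound `exp (q²τ²)` is far too large. -/
theorem tendsto_pow_mul_mills_div {p q : ℝ} (hp : 0 < p) (hq : q < p) (k : ℕ) :
    Tendsto (fun τ => τ ^ k * (mills (q * τ) / mills (p * τ))) atTop (𝓝 0) := by
  set κ := max q 0 with hκ
  have hκ0 : 0 ≤ κ := le_max_right _ _
  have hκp : κ < p := max_lt hq hp
  set c := p ^ 2 - κ ^ 2 with hc
  have hc0 : 0 < c := by nlinarith
  have h1 := ((Real.tendsto_pow_mul_exp_neg_atTop_nhds_zero k).comp
    (tendsto_id.const_mul_atTop hc0)).const_mul (2 * (c ^ k)⁻¹)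
  rw [mul_zero] at h1
  refine squeeze_zero' ?_ ?_ h1
  · filter_upwards [eventually_ge_atTop 0] with τ hτ
    have := mills_pos (q * τ)
    have := mills_pos (p * τ)
    positivity
  · filter_upwards [eventually_ge_atTop 1] with τ hτ
    have hτ0 : 0 ≤ τ := by linarith
    have e1 : mills (q * τ) ≤ Real.exp ((κ * τ) ^ 2) :=
      (strictMono_mills.monotone (mul_le_mul_of_nonneg_right (le_max_left _ _) hτ0)).trans
        (mills_le_exp _)
    have e2 := half_exp_le_mills (r := p * τ) (by positivity)
    have e3 : Real.exp ((κ * τ) ^ 2) ≤ Real.exp (-(c * τ)) * Real.exp ((p * τ) ^ 2) := by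
      rw [← Real.exp_add, Real.exp_le_exp]
      have : c * τ ≤ c * τ ^ 2 := mul_le_mul_of_nonneg_left (by nlinarith) hc0.le
      rw [hc] at this ⊢
      linarith
    have e4 : mills (q * τ) / mills (p * τ) ≤ 2 * Real.exp (-(c * τ)) := by
      rw [div_le_iff₀ (mills_pos _)]
      have := mul_le_mul_of_nonneg_left e2 (Real.exp_pos (-(c * τ))).le
      linarith
    have e5 : 2 * (c ^ k)⁻¹ * ((c * τ) ^ k * Real.exp (-(c * τ)))
        = τ ^ k * (2 * Real.exp (-(c * τ))) := by
      rw [mul_pow]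
      field_simp
    simp only [Function.comp, id, e5]
    exact mul_le_mul_of_nonneg_left e4 (by positivity)

theorem tendsto_mills_div {p q : ℝ} (hp : 0 < p) (hq : q < p) :
    Tendsto (fun τ => mills (q * τ) / mills (p * τ)) atTop (𝓝 0) := by
  simpa using tendsto_pow_mul_mills_div hp hq 0

theorem tendsto_millsSlope_div {a b x t : ℝ} (hp : 0 < x - a * t) (hx : 0 < x)
    (hr : b * t - x < x - a * t) :
    Tendsto (fun τ => millsSlope a b x t τ / mills ((x - a * t) * τ)) atTop (𝓝 0) := by
  unfold millsSlope
  split_ifs with hab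
  · have h1 := (tendsto_pow_mul_mills_div hp hr 2).const_mul (2 * t * (b * t - x))
    -- The constant `1/√π` in `millsD` is treated as `2/√π · M(0 · τ)`, that is, with `q = 0`.
    have h2 := (tendsto_pow_mul_mills_div hp hp 1).const_mul (2 * t * (√Real.pi)⁻¹)
    have h3 := h1.add h2
    rw [mul_zero, mul_zero, add_zero] at h3
    refine h3.congr fun τ => ?_
    rw [zero_mul, mills_zero, millsD]
    ring
  · have h := ((tendsto_mills_div hp hr).sub
      (tendsto_mills_div (q := -x - a * t) hp (by linarith))).div_const (a + b)
    rw [sub_zero, zero_div] at h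
    refine h.congr fun τ => ?_
    ring

/-- The initial value wins. -/
theorem tendsto_burgersProfile_initial {a b x t : ℝ} (hx : 0 < x) (hp : a * t < x)
    (hr : (a + b) * t < 2 * x) :
    Tendsto (burgersProfile a b x t) atTop (𝓝 a) := by
  have hp' : 0 < x - a * t := by linarith
  have hQ := tendsto_mills_div (q := -x - a * t) hp' (by linarith)
  have hR := tendsto_mills_div (q := b * t - x) hp' (by linarith)
  have hM := tendsto_millsSlope_div (b := b) hp' hx (by linarith)
  have h := (((hQ.const_sub 1).div ((hR.const_add 1).add (hM.const_mul (b - a)))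
    (by norm_num)).const_mul (a - b)).const_add b
  have e : b + (a - b) * ((1 - 0) / (1 + 0 + (b - a) * 0)) = a := by ring
  rw [e] at h
  refine h.congr fun τ => ?_
  have := (mills_pos ((x - a * t) * τ)).ne'
  simp only [burgersProfile, robinProfile, Pi.div_apply]
  generalize mills ((x - a * t) * τ) = P at this
  congr 2
  rw [← mul_div_mul_right _ _ this]
  congr 1
  · field_simp
  · field_simp

/-- The boundary value wins. -/
theorem tendsto_burgersProfile_boundary {a b x t : ℝ} (hx : 0 < x) (ht : 0 < t)
    (hr : x < b * t) (hp : 2 * x < (a + b) * t) :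
    Tendsto (burgersProfile a b x t) atTop (𝓝 b) := by
  have hr' : 0 < b * t - x := by linarith
  have hab : 0 < a + b := by
    by_contra! h
    nlinarith
  have hb : 0 < b := by
    by_contra! h
    nlinarith
  have hQ := tendsto_mills_div (q := -x - a * t) hr' (by linarith)
  have hP := tendsto_mills_div (q := x - a * t) hr' (by linarith)
  -- Relative to `R`, the denominator tends to `1 + (b - a)/(a + b) = 2b/(a + b)`, which is
  -- positive, while `P - Q` is negligible.
  have hne : 0 + 1 + (b - a) * ((1 - 0) / (a + b)) ≠ 0 := by
    have : 0 + 1 + (b - a) * ((1 - 0) / (a + b)) = 2 * b / (a + b) := by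
      field_simp
      ring
    rw [this]
    positivity
  have h := (((hP.sub hQ).div ((hP.add_const 1).add
    (((hQ.const_sub 1).div_const (a + b)).const_mul (b - a))) hne).const_mul (a - b)).const_add b
  rw [sub_zero, zero_div, mul_zero, add_zero] at h
  refine h.congr fun τ => ?_
  have := (mills_pos ((b * t - x) * τ)).ne'
  simp only [burgersProfile, robinProfile, millsSlope, if_neg hab.ne', Pi.div_apply]
  generalize mills ((b * t - x) * τ) = P at this
  generalize mills ((-x - a * t) * τ) = Q
  congr 2
  rw [← mul_div_mul_right _ _ this]
  congr 1
  · field_simp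
  · field_simp

theorem tendsto_mul_mills_of_neg {q : ℝ} (hq : q < 0) :
    Tendsto (fun τ => τ * mills (q * τ)) atTop (𝓝 ((√Real.pi)⁻¹ / 2 * (-q)⁻¹)) := by
  have hq' : 0 < -q := by linarith
  have h := (tendsto_mul_mills_neg.comp (tendsto_id.const_mul_atTop hq')).mul_const (-q)⁻¹
  refine h.congr fun τ => ?_
  have := hq.ne
  simp only [Function.comp, id, neg_mul, neg_neg]
  field_simp

theorem tendsto_sq_mul_millsD_of_neg {q : ℝ} (hq : q < 0) :
    Tendsto (fun τ => τ ^ 2 * millsD (q * τ)) atTop (𝓝 ((√Real.pi)⁻¹ / 2 * ((-q)⁻¹) ^ 2)) := by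
  have hq' : 0 < -q := by linarith
  have h := (tendsto_sq_mul_millsD_neg.comp (tendsto_id.const_mul_atTop hq')).mul_const
    (((-q)⁻¹) ^ 2)
  refine h.congr fun τ => ?_
  have := hq.ne
  simp only [Function.comp, id, neg_mul, neg_neg]
  field_simp

theorem tendsto_mul_millsSlope {a b x t : ℝ} (ht : 0 < t) (hq : -x - a * t < 0) (hr : b * t - x < 0) :
    Tendsto (fun τ => τ * millsSlope a b x t τ) atTop
      (𝓝 ((√Real.pi)⁻¹ / 2 * (t / ((x - b * t) * (x + a * t))))) := by
  have h1 : x - b * t ≠ 0 := by linarith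
  have h2 : x + a * t ≠ 0 := by linarith
  unfold millsSlope
  split_ifs with hab
  · obtain rfl : b = -a := by linarith
    have h := (tendsto_sq_mul_millsD_of_neg hr).const_mul t
    have e : t * ((√Real.pi)⁻¹ / 2 * (-(-a * t - x))⁻¹ ^ 2)
        = (√Real.pi)⁻¹ / 2 * (t / ((x - -a * t) * (x + a * t))) := by
      have e1 : -(-a * t - x) = x + a * t := by ring
      have e2 : x - -a * t = x + a * t := by ring
      rw [e1, e2]
      field_simp
    rw [e] at h
    refine h.congr fun τ => ?_
    ring
  · have h := ((tendsto_mul_mills_of_neg hr).sub (tendsto_mul_mills_of_neg hq)).div_const (a + b)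
    have e : ((√Real.pi)⁻¹ / 2 * (-(b * t - x))⁻¹ - (√Real.pi)⁻¹ / 2 * (-(-x - a * t))⁻¹) / (a + b)
        = (√Real.pi)⁻¹ / 2 * (t / ((x - b * t) * (x + a * t))) := by
      have e1 : -(b * t - x) = x - b * t := by ring
      have e2 : -(-x - a * t) = x + a * t := by ring
      have e3 : a + b = ((x + a * t) - (x - b * t)) / t := by
        field_simp
        ring
      have hab' := hab
      rw [e3] at hab'
      rw [e1, e2, e3]
      generalize x - b * t = B at h1 hab'
      generalize x + a * t = D at h2 hab'
      have hne : D - B ≠ 0 := fun h => hab' (by rw [h, zero_div])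
      field_simp
    rw [e] at h
    refine h.congr fun τ => ?_
    ring

/-- The rarefaction fan. -/
theorem tendsto_burgersProfile_fan {a b x t : ℝ} (hx : 0 < x) (ht : 0 < t)
    (hp : x < a * t) (hr : b * t < x) :
    Tendsto (burgersProfile a b x t) atTop (𝓝 (x / t)) := by
  have hP := tendsto_mul_mills_of_neg (q := x - a * t) (by linarith)
  have hQ := tendsto_mul_mills_of_neg (q := -x - a * t) (by linarith)
  have hR := tendsto_mul_mills_of_neg (q := b * t - x) (by linarith)
  have hM := tendsto_mul_millsSlope (a := a) (b := b) (x := x) ht (by linarith)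
    (by linarith)
  have h1 : 0 < a * t - x := by linarith
  have h2 : 0 < x - b * t := by linarith
  have h3 : 0 < x + a * t := by linarith
  have h4 : 0 < a - b := by
    by_contra! h
    nlinarith
  have hc : 0 < (√Real.pi)⁻¹ / 2 := by
    have := sqrt_pi_pos
    positivity
  have e1 : -(x - a * t) = a * t - x := by ring
  have e2 : -(b * t - x) = x - b * t := by ring
  have e3 : -(-x - a * t) = x + a * t := by ring
  rw [e1] at hP
  rw [e2] at hR
  rw [e3] at hQ
  generalize (√Real.pi)⁻¹ / 2 = c at hc hP hQ hR hM
  -- This is the limit of `τ D`. With `A = at - x`, `B = x - bt` and `E = x + at` one has `A + B =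
  -- (a - b)t` and `E - A = 2x`, and the sum of fractions is `(A + B)(E - A)/(A B E)`.
  have hden : c * (a * t - x)⁻¹ + c * (x - b * t)⁻¹
      + (b - a) * (c * (t / ((x - b * t) * (x + a * t))))
      = c * (2 * (a - b) * t * x / ((a * t - x) * (x - b * t) * (x + a * t))) := by
    have h5 : b - a = -((a * t - x) + (x - b * t)) / t := by
      field_simp
      ring
    have h6 : 2 * (a - b) * t * x
        = ((a * t - x) + (x - b * t)) * ((x + a * t) - (a * t - x)) := by ring
    rw [h5, h6]
    generalize a * t - x = A at h1
    generalize x - b * t = B at h2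
    generalize x + a * t = D at h3
    field_simp
    ring
  have hne : c * (a * t - x)⁻¹ + c * (x - b * t)⁻¹
      + (b - a) * (c * (t / ((x - b * t) * (x + a * t)))) ≠ 0 := by
    rw [hden]
    positivity
  have h := (((hP.sub hQ).div ((hP.add hR).add (hM.const_mul (b - a))) hne).const_mul
    (a - b)).const_add b
  have hlim : b + (a - b) * ((c * (a * t - x)⁻¹ - c * (x + a * t)⁻¹)
      / (c * (a * t - x)⁻¹ + c * (x - b * t)⁻¹
        + (b - a) * (c * (t / ((x - b * t) * (x + a * t)))))) = x / t := by
    have h5 : b = (x - (x - b * t)) / t := by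
      field_simp
      ring
    have h6 : (a * t - x)⁻¹ - (x + a * t)⁻¹ = 2 * x / ((a * t - x) * (x + a * t)) := by
      rw [inv_sub_inv h1.ne' h3.ne']
      ring
    rw [hden, ← mul_sub, h6]
    generalize a * t - x = A at h1
    generalize x + a * t = D at h3
    generalize a - b = E at h4
    nth_rewrite 1 [h5]
    generalize x - b * t = B at h2
    field_simp
    ring
  rw [hlim] at h
  refine h.congr' ?_
  filter_upwards [eventually_gt_atTop 0] with τ hτ
  simp only [burgersProfile, robinProfile, Pi.div_apply]
  congr 2
  symm
  rw [← mul_div_mul_left _ _ hτ.ne']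
  congr 1 <;> ring

/-- The entropy solution of the inviscid problem with initial value `a` and boundary datum `b`. -/
noncomputable def limitSpeed (a b x t : ℝ) : ℝ :=
  if a < b then if x < (a + b) / 2 * t then b else a else max b (min a (x / t))

theorem tendsto_burgersProfile {a b x t : ℝ} (hx : 0 < x) (ht : 0 < t)
    (h1 : x ≠ (a + b) / 2 * t) (h2 : x ≠ a * t) (h3 : x ≠ b * t) :
    Tendsto (burgersProfile a b x t) atTop (𝓝 (limitSpeed a b x t)) := by
  unfold limitSpeed
  split_ifs with hab hs
  -- To the left of the shock, `x < (a + b)t/2 < bt` since `a < b`.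
  · exact tendsto_burgersProfile_boundary hx ht (by nlinarith) (by linarith)
  · have : (a + b) / 2 * t < x := lt_of_le_of_ne (not_lt.1 hs) h1.symm
    exact tendsto_burgersProfile_initial hx (by nlinarith) (by linarith)
  · have hba : b ≤ a := not_lt.1 hab
    have hbat : b * t ≤ a * t := mul_le_mul_of_nonneg_right hba ht.le
    rcases lt_or_gt_of_ne h2 with h | h
    · have ha : x / t ≤ a := ((div_lt_iff₀ ht).2 h).le
      rw [min_eq_right ha]
      rcases lt_or_gt_of_ne h3 with h' | h'
      · rw [max_eq_left ((div_lt_iff₀ ht).2 h').le]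
        exact tendsto_burgersProfile_boundary hx ht h' (by linarith)
      · rw [max_eq_right ((lt_div_iff₀ ht).2 h').le]
        exact tendsto_burgersProfile_fan hx ht h h'
    · rw [min_eq_left ((lt_div_iff₀ ht).2 h).le, max_eq_right hba]
      exact tendsto_burgersProfile_initial hx h (by linarith)

theorem tendsto_inv_sqrt_atTop {t : ℝ} (ht : 0 < t) :
    Tendsto (fun ε => (√(4 * ε * t))⁻¹) (𝓝[>] 0) atTop := by
  refine Tendsto.inv_tendsto_nhdsGT_zero (tendsto_nhdsWithin_iff.2 ⟨?_, ?_⟩)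
  · have h : Continuous fun ε => √(4 * ε * t) := by fun_prop
    have := (h.tendsto 0).mono_left (nhdsWithin_le_nhds (s := Ioi 0))
    simpa using this
  · filter_upwards [self_mem_nhdsWithin] with ε hε
    have : 0 < ε := hε
    exact Real.sqrt_pos.2 (by positivity)

/-! ### Test functions -/

theorem measurableSet_quarterPlane : MeasurableSet quarterPlane :=
  isOpen_quarterPlane.measurableSet

theorem integrableOn_mul_of_bounded {f ψ : ℝ × ℝ → ℝ} {C : ℝ}
    (hf : AEStronglyMeasurable f (volume.restrict quarterPlane))
    (hC : ∀ p ∈ quarterPlane, |f p| ≤ C) (hψ : Continuous ψ) (hc : HasCompactSupport ψ) :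
    Integrable (fun p => f p * ψ p) (volume.restrict quarterPlane) := by
  have hi : Integrable ψ (volume.restrict quarterPlane) :=
    (hψ.integrable_of_hasCompactSupport hc).restrict
  exact hi.bdd_mul hf ((ae_restrict_mem measurableSet_quarterPlane).mono hC)

namespace IsTestFunction

variable {φ : ℝ × ℝ → ℝ}

theorem hasCompactSupport_fderiv_apply (h : IsTestFunction φ) (v : ℝ × ℝ) :
    HasCompactSupport fun p => fderiv ℝ φ p v := h.compact.fderiv_apply ℝ v

theorem contDiff_fderiv (h : IsTestFunction φ) : ContDiff ℝ ∞ (fderiv ℝ φ) :=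
  h.smooth.fderiv_right (by norm_cast)

theorem contDiff_fderiv_apply (h : IsTestFunction φ) (v : ℝ × ℝ) :
    ContDiff ℝ ∞ fun p => fderiv ℝ φ p v := h.contDiff_fderiv.clm_apply contDiff_const

theorem fderiv_eq_zero (h : IsTestFunction φ) {p : ℝ × ℝ} (hp : p ∉ quarterPlane) :
    fderiv ℝ φ p = 0 := by
  by_contra hne
  exact hp (h.support (support_fderiv_subset ℝ (Function.mem_support.2 hne)))

theorem setIntegral_mul_fderiv (h : IsTestFunction φ) (f : ℝ × ℝ → ℝ) (v : ℝ × ℝ) :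
    ∫ p in quarterPlane, f p * fderiv ℝ φ p v = ∫ p, f p * fderiv ℝ φ p v :=
  setIntegral_eq_integral_of_forall_compl_eq_zero fun p hp => by
    rw [h.fderiv_eq_zero hp, zero_apply, mul_zero]

theorem setIntegral_fderiv_eq_zero (h : IsTestFunction φ) (v : ℝ × ℝ) :
    ∫ p in quarterPlane, fderiv ℝ φ p v = 0 := by
  obtain ⟨D, hD⟩ := h.smooth.lipschitzWith_of_hasCompactSupport h.compact (by simp)
  have h1 := LipschitzWith.integral_lineDeriv_mul_eq (μ := volume)
    (LipschitzWith.const (α := ℝ × ℝ) (1 : ℝ)) hD h.compact (-v)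
  have h2 := h.setIntegral_mul_fderiv 1 v
  simp only [Pi.one_apply, one_mul] at h2
  rw [h2]
  have h0 : ∀ p : ℝ × ℝ, lineDeriv ℝ (fun _ : ℝ × ℝ => (1 : ℝ)) p (-v) = 0 := fun p => by
    simp [lineDeriv]
  simp only [h0, zero_mul, integral_zero, neg_neg, mul_one] at h1
  rw [h1]
  refine integral_congr_ae (ae_of_all _ fun p => ?_)
  exact ((h.smooth.differentiable (by simp)) p).lineDeriv_eq_fderiv.symm

/-- For a Lipschitz function `S`, the mixed second derivatives commute weakly. -/
theorem integral_lineDeriv_comm (h : IsTestFunction φ) {S : ℝ × ℝ → ℝ} {C : NNReal}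
    (hS : LipschitzWith C S) (v v' : ℝ × ℝ) :
    ∫ p, lineDeriv ℝ S p v * fderiv ℝ φ p v' = ∫ p, lineDeriv ℝ S p v' * fderiv ℝ φ p v := by
  have key : ∀ v v' : ℝ × ℝ, ∫ p, lineDeriv ℝ S p v * fderiv ℝ φ p v'
      = ∫ p, -(fderiv ℝ (fderiv ℝ φ) p v v') * S p := by
    intro v v'
    obtain ⟨D, hD⟩ := (h.contDiff_fderiv_apply v').lipschitzWith_of_hasCompactSupport
      (h.hasCompactSupport_fderiv_apply v') (by simp)
    rw [LipschitzWith.integral_lineDeriv_mul_eq hS hD (h.hasCompactSupport_fderiv_apply v') v]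
    refine integral_congr_ae (ae_of_all _ fun p => ?_)
    have hd : DifferentiableAt ℝ (fderiv ℝ φ) p := h.contDiff_fderiv.differentiable (by simp) p
    have hd' : DifferentiableAt ℝ (fun p => fderiv ℝ φ p v') p :=
      (h.contDiff_fderiv_apply v').differentiable (by simp) p
    simp only
    rw [hd'.lineDeriv_eq_fderiv, fderiv_clm_apply hd (differentiableAt_const v')]
    simp
  rw [key, key]
  congr 1
  ext p
  have hsymm : IsSymmSndFDerivAt ℝ φ p :=
    (h.smooth.contDiffAt).isSymmSndFDerivAt (by
      rw [minSmoothness_of_isRCLikeNormedField]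
      norm_cast)
  rw [hsymm v v']

end IsTestFunction

/-! ### Weak solutions of Burgers' equation as envelopes of linear functions -/

theorem abs_line_sub_le {v C : ℝ} (hv : |v| ≤ C) (p q : ℝ × ℝ) :
    |(v * p.1 - v ^ 2 / 2 * p.2) - (v * q.1 - v ^ 2 / 2 * q.2)| ≤ (C + C ^ 2 / 2) * dist p q := by
  have h1 : |p.1 - q.1| ≤ dist p q := by
    rw [Prod.dist_eq, ← Real.dist_eq]
    exact le_max_left _ _
  have h2 : |p.2 - q.2| ≤ dist p q := by
    rw [Prod.dist_eq, ← Real.dist_eq]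
    exact le_max_right _ _
  have hC : 0 ≤ C := (abs_nonneg v).trans hv
  have hv2 : v ^ 2 ≤ C ^ 2 := sq_le_sq' (abs_le.1 hv).1 (abs_le.1 hv).2
  have e : (v * p.1 - v ^ 2 / 2 * p.2) - (v * q.1 - v ^ 2 / 2 * q.2)
      = v * (p.1 - q.1) - v ^ 2 / 2 * (p.2 - q.2) := by ring
  rw [e]
  refine (abs_sub _ _).trans ?_
  rw [abs_mul, abs_mul, abs_of_nonneg (by positivity : 0 ≤ v ^ 2 / 2), add_mul]
  exact add_le_add (mul_le_mul hv h1 (abs_nonneg _) hC)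
    (mul_le_mul (by linarith) h2 (abs_nonneg _) (by positivity))

/-- If the linear functions `v x - v² t / 2` with slopes `v` among the values of `U` have an
envelope, which at each point is attained at the slope `U`, then `U` is a weak solution of
Burgers' equation. -/
theorem burgers_weak_of_envelope {U : ℝ × ℝ → ℝ} {C ς : ℝ} (hς : ς = 1 ∨ ς = -1)
    (hm : Measurable U) (hU : ∀ p ∈ quarterPlane, |U p| ≤ C)
    (henv : ∀ p ∈ quarterPlane, ∀ q ∈ quarterPlane,
      ς * (U q * p.1 - U q ^ 2 / 2 * p.2) ≤ ς * (U p * p.1 - U p ^ 2 / 2 * p.2))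
    {φ : ℝ × ℝ → ℝ} (hφ : IsTestFunction φ) :
    ∫ p in quarterPlane, (U p * fderiv ℝ φ p (0, 1) + U p ^ 2 / 2 * fderiv ℝ φ p (1, 0)) = 0 := by
  have hC : 0 ≤ C := (abs_nonneg _).trans (hU (1, 1) ⟨mem_Ioi.2 one_pos, mem_Ioi.2 one_pos⟩)
  -- At either of two points the line chosen at the other one is no better, so the envelope varies
  -- no more than the lines, whose slopes are bounded by `C`.
  have hlip : LipschitzOnWith (C + C ^ 2 / 2).toNNReal
      (fun p => U p * p.1 - U p ^ 2 / 2 * p.2) quarterPlane := by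
    refine LipschitzOnWith.of_dist_le_mul fun p hp q hq => ?_
    rw [Real.coe_toNNReal _ (by positivity), Real.dist_eq, abs_le]
    have h1 := abs_le.1 (abs_line_sub_le (hU p hp) p q)
    have h2 := abs_le.1 (abs_line_sub_le (hU q hq) p q)
    have h3 := henv p hp q hq
    have h4 := henv q hq p hp
    rcases hς with rfl | rfl <;> constructor <;> linarith
  obtain ⟨S, hS, hSeq⟩ := hlip.extend_real
  have hgrad : ∀ᵐ p, p ∈ quarterPlane →
      lineDeriv ℝ S p (1, 0) = U p ∧ lineDeriv ℝ S p (0, 1) = -(U p ^ 2 / 2) := by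
    filter_upwards [hS.ae_differentiableAt] with p hdiff hp
    set ℓ : ℝ × ℝ →L[ℝ] ℝ :=
      U p • ContinuousLinearMap.fst ℝ ℝ ℝ - (U p ^ 2 / 2) • ContinuousLinearMap.snd ℝ ℝ ℝ with hℓ
    have hℓv : ∀ q, ℓ q = U p * q.1 - U p ^ 2 / 2 * q.2 := fun q => by simp [hℓ]
    -- The line chosen at `p` touches the envelope at `p` from one side, so wherever `S` is
    -- differentiable (almost everywhere, by Rademacher) its gradient is that of the line.
    have hmin : IsLocalMin (fun q => ς * (S q - ℓ q)) p := by
      filter_upwards [isOpen_quarterPlane.mem_nhds hp] with q hq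
      rw [← hSeq hq, ← hSeq hp, hℓv, hℓv]
      have := henv q hq p hp
      linarith
    have hd := hmin.hasFDerivAt_eq_zero
      ((hdiff.hasFDerivAt.fun_sub ℓ.hasFDerivAt).const_mul ς)
    have hς0 : ς ≠ 0 := by rcases hς with rfl | rfl <;> norm_num
    have hfd : fderiv ℝ S p = ℓ := sub_eq_zero.1 ((smul_eq_zero.1 hd).resolve_left hς0)
    rw [hdiff.lineDeriv_eq_fderiv, hdiff.lineDeriv_eq_fderiv, hfd, hℓv, hℓv]
    constructor <;> simp
  have hcomm := hφ.integral_lineDeriv_comm hS (1, 0) (0, 1)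
  rw [← hφ.setIntegral_mul_fderiv, ← hφ.setIntegral_mul_fderiv] at hcomm
  have e1 : ∫ p in quarterPlane, lineDeriv ℝ S p (1, 0) * fderiv ℝ φ p (0, 1)
      = ∫ p in quarterPlane, U p * fderiv ℝ φ p (0, 1) := by
    refine setIntegral_congr_ae measurableSet_quarterPlane ?_
    filter_upwards [hgrad] with p h hp
    rw [(h hp).1]
  have e2 : ∫ p in quarterPlane, lineDeriv ℝ S p (0, 1) * fderiv ℝ φ p (1, 0)
      = -∫ p in quarterPlane, U p ^ 2 / 2 * fderiv ℝ φ p (1, 0) := by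
    rw [← integral_neg]
    refine setIntegral_congr_ae measurableSet_quarterPlane ?_
    filter_upwards [hgrad] with p h hp
    rw [(h hp).2, neg_mul]
  rw [e1, e2] at hcomm
  rw [integral_add, hcomm, neg_add_cancel]
  · exact integrableOn_mul_of_bounded hm.aestronglyMeasurable hU
      (hφ.contDiff_fderiv_apply _).continuous (hφ.hasCompactSupport_fderiv_apply _)
  · refine integrableOn_mul_of_bounded (f := fun p => U p ^ 2 / 2) (C := C ^ 2 / 2)
      (by fun_prop) (fun p hp => ?_)
      (hφ.contDiff_fderiv_apply _).continuous (hφ.hasCompactSupport_fderiv_apply _)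
    have := abs_le.1 (hU p hp)
    rw [abs_of_nonneg (by positivity)]
    have := sq_le_sq' this.1 this.2
    linarith

theorem measurable_limitSpeed (a b : ℝ) :
    Measurable fun p : ℝ × ℝ => limitSpeed a b p.1 p.2 := by
  unfold limitSpeed
  split_ifs
  · exact Measurable.ite (measurableSet_lt (by fun_prop) (by fun_prop)) measurable_const
      measurable_const
  · fun_prop

theorem abs_limitSpeed_le (a b x t : ℝ) : |limitSpeed a b x t| ≤ |a| + |b| := by
  have ha := abs_nonneg a
  have hb := abs_nonneg b
  unfold limitSpeed
  split_ifs with h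
  · linarith
  · linarith
  · have h1 := abs_le.1 (le_refl |a|)
    have h2 := abs_le.1 (le_refl |b|)
    rw [abs_le]
    constructor
    · linarith [le_max_left b (min a (x / t))]
    · refine max_le (by linarith) ((min_le_left _ _).trans (by linarith))

theorem limitSpeed_mem_Icc {a b : ℝ} (h : b ≤ a) (x t : ℝ) : limitSpeed a b x t ∈ Icc b a := by
  unfold limitSpeed
  rw [if_neg (not_lt.2 h)]
  exact ⟨le_max_left _ _, max_le h (min_le_left _ _)⟩

/-- If `b ≤ a`, the value is the projection of `x/t` to `[b, a]`, the maximizer there of the concave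
function `v ↦ v x - v² t/2`. If `a < b`, it is the minimizer over the two values `a`, `b`; the two
lines agree on `x = (a + b)t/2`, the shock with the Rankine-Hugoniot speed. -/
theorem burgers_weak_limitSpeed (a b : ℝ) {φ : ℝ × ℝ → ℝ} (hφ : IsTestFunction φ) :
    ∫ p in quarterPlane, (limitSpeed a b p.1 p.2 * fderiv ℝ φ p (0, 1)
      + limitSpeed a b p.1 p.2 ^ 2 / 2 * fderiv ℝ φ p (1, 0)) = 0 := by
  rcases lt_or_ge a b with hab | hba
  · refine burgers_weak_of_envelope (U := fun p => limitSpeed a b p.1 p.2) (ς := -1) (Or.inr rfl)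
      (measurable_limitSpeed a b) (fun p _ => abs_limitSpeed_le a b p.1 p.2) ?_ hφ
    rintro p - q -
    simp only [limitSpeed, if_pos hab]
    split_ifs with h1 h2 h2
    · exact le_rfl
    · nlinarith
    · nlinarith
    · exact le_rfl
  · refine burgers_weak_of_envelope (U := fun p => limitSpeed a b p.1 p.2) (ς := 1) (Or.inl rfl)
      (measurable_limitSpeed a b) (fun p _ => abs_limitSpeed_le a b p.1 p.2) ?_ hφ
    rintro ⟨x, t⟩ ⟨-, ht⟩ q -
    have ht' : 0 < t := ht
    obtain ⟨h1, h2⟩ := limitSpeed_mem_Icc hba q.1 q.2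
    obtain ⟨h3, h4⟩ := limitSpeed_mem_Icc hba x t
    simp only [one_mul]
    set v := limitSpeed a b q.1 q.2
    have hx : x = x / t * t := by field_simp
    -- This is the difference of the two line values at `(x, t)`, divided by `t`.
    have key : 0 ≤ (limitSpeed a b x t - v) * (x / t - (limitSpeed a b x t + v) / 2) := by
      unfold limitSpeed at h3 h4 ⊢
      rw [if_neg (not_lt.2 hba)] at h3 h4 ⊢
      generalize x / t = y at *
      rcases le_total a y with h5 | h5
      · rw [min_eq_left h5, max_eq_right hba] at *
        exact mul_nonneg (by linarith) (by linarith)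
      · rw [min_eq_right h5] at *
        rcases le_total b y with h6 | h6
        · rw [max_eq_right h6]
          nlinarith [sq_nonneg (y - v)]
        · rw [max_eq_left h6]
          exact mul_nonneg_of_nonpos_of_nonpos (by linarith) (by linarith)
    have := mul_nonneg key ht'.le
    have e : (limitSpeed a b x t - v) * (x / t - (limitSpeed a b x t + v) / 2) * t
        = limitSpeed a b x t * x - limitSpeed a b x t ^ 2 / 2 * t - (v * x - v ^ 2 / 2 * t) := by
      field_simp
      ring
    linarith

/-! ### Initial trace, exceptional rays and passage to the limit -/

theorem tendsto_limitSpeed_initial (a b : ℝ) {x : ℝ} (hx : 0 < x) :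
    Tendsto (fun t => limitSpeed a b x t) (𝓝[>] 0) (𝓝 a) := by
  have hlim : ∀ m : ℝ, ∀ᶠ t in 𝓝[>] (0 : ℝ), m * t < x := fun m => by
    have h : Continuous fun t : ℝ => m * t := by fun_prop
    have := (h.tendsto 0).mono_left (nhdsWithin_le_nhds (s := Ioi 0))
    rw [mul_zero] at this
    exact this.eventually_lt_const hx
  refine tendsto_const_nhds.congr' ?_
  filter_upwards [hlim ((a + b) / 2), hlim a, self_mem_nhdsWithin] with t h1 h2 ht
  have ht' : 0 < t := ht
  unfold limitSpeed
  split_ifs with hab hs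
  · exact absurd hs (not_lt.2 h1.le)
  · rfl
  · rw [min_eq_left ((lt_div_iff₀ ht').2 h2).le, max_eq_right (not_lt.1 hab)]

theorem ae_ne_ray (m : ℝ) : ∀ᵐ p : ℝ × ℝ, p.1 ≠ m * p.2 := by
  set f : ℝ × ℝ →ₗ[ℝ] ℝ := LinearMap.fst ℝ ℝ ℝ - m • LinearMap.snd ℝ ℝ ℝ with hf
  have hne : LinearMap.ker f ≠ ⊤ := fun h => by
    have : ((1, 0) : ℝ × ℝ) ∈ LinearMap.ker f := h ▸ Submodule.mem_top
    simp [hf] at this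
  have h0 := Measure.addHaar_submodule (volume : Measure (ℝ × ℝ)) _ hne
  refine measure_mono_null (fun p hp => ?_) h0
  simp only [mem_compl_iff, mem_ofPred_eq, not_not] at hp
  simp [hf, hp]

theorem measurable_burgersProfile (a b ε : ℝ) :
    Measurable fun p : ℝ × ℝ => burgersProfile a b p.1 p.2 (√(4 * ε * p.2))⁻¹ := by
  have h1 := continuous_mills.measurable
  have h2 := continuous_millsD.measurable
  unfold burgersProfile robinProfile millsSlope
  split_ifs <;> fun_prop

theorem signedSpeed_eq (k : ℝ) {j : ℕ} : (-1) ^ j * k = -signedSpeed k j := by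
  rw [signedSpeed, pow_succ]
  ring

theorem signedSpeed_sq (k : ℝ) (j : ℕ) : signedSpeed k j ^ 2 = k ^ 2 := by
  rw [signedSpeed, mul_pow, ← pow_mul, mul_comm (j + 1) 2, pow_mul]
  simp

theorem tendsto_viscousU {a b x t : ℝ} {w : ℝ → ℝ → ℝ → ℝ}
    (hw : ∀ ε > 0, IsHopfColeSolution ε a b (w ε)) (hx : 0 < x) (ht : 0 < t)
    (h1 : x ≠ (a + b) / 2 * t) (h2 : x ≠ a * t) (h3 : x ≠ b * t) (k : ℝ) (j : ℕ) :
    Tendsto (fun ε => viscousU k j ε (w ε) x t) (𝓝[>] 0)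
      (𝓝 (limitSpeed a b x t + signedSpeed k j)) := by
  have h := ((tendsto_burgersProfile hx ht h1 h2 h3).comp (tendsto_inv_sqrt_atTop ht)).add_const
    (signedSpeed k j)
  refine h.congr' ?_
  filter_upwards [self_mem_nhdsWithin] with ε hε
  exact (viscousU_eq hε (hw ε hε) hx ht k j).symm

theorem ae_tendsto_viscousU {a b : ℝ} {w : ℝ → ℝ → ℝ → ℝ}
    (hw : ∀ ε > 0, IsHopfColeSolution ε a b (w ε)) (k : ℝ) (j : ℕ) :
    ∀ᵐ p ∂(volume.restrict quarterPlane),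
      Tendsto (fun ε => viscousU k j ε (w ε) p.1 p.2) (𝓝[>] 0)
        (𝓝 (limitSpeed a b p.1 p.2 + signedSpeed k j)) := by
  filter_upwards [ae_restrict_mem measurableSet_quarterPlane,
    ae_restrict_of_ae (ae_ne_ray ((a + b) / 2)), ae_restrict_of_ae (ae_ne_ray a),
    ae_restrict_of_ae (ae_ne_ray b)] with p hp h1 h2 h3
  exact tendsto_viscousU hw hp.1 hp.2 h1 h2 h3 k j

/-- Dominated convergence: the profile formula supplies both measurability and a majorant
independent of `ε`. -/
theorem tendsto_integral_viscousSigma {a b : ℝ} {w : ℝ → ℝ → ℝ → ℝ}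
    (hw : ∀ ε > 0, IsHopfColeSolution ε a b (w ε)) (k : ℝ) (j : ℕ) (c : ℝ) {φ : ℝ × ℝ → ℝ}
    (hφ : IsTestFunction φ) :
    Tendsto (fun ε => ∫ p in quarterPlane, viscousSigma k j c ε (w ε) p.1 p.2 * φ p) (𝓝[>] 0)
      (𝓝 (∫ p in quarterPlane, (signedSpeed k j * (limitSpeed a b p.1 p.2 + signedSpeed k j) + c)
        * φ p)) := by
  set α := signedSpeed k j with hα
  have hφi : Integrable φ (volume.restrict quarterPlane) :=
    (hφ.smooth.continuous.integrable_of_hasCompactSupport hφ.compact).restrict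
  have heq : ∀ ε > 0, ∀ p ∈ quarterPlane, viscousSigma k j c ε (w ε) p.1 p.2
      = α * (burgersProfile a b p.1 p.2 (√(4 * ε * p.2))⁻¹ + α) + c := fun ε hε p hp => by
    rw [viscousSigma, viscousU_eq hε (hw ε hε) hp.1 hp.2]
  refine tendsto_integral_filter_of_dominated_convergence
    (fun p => (|α| * ((|b| + |a - b|) + |α|) + |c|) * |φ p|) ?_ ?_ (hφi.abs.const_mul _) ?_
  · filter_upwards [self_mem_nhdsWithin] with ε hε
    have hm : Measurable fun p : ℝ × ℝ =>
        (α * (burgersProfile a b p.1 p.2 (√(4 * ε * p.2))⁻¹ + α) + c) * φ p := by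
      have h1 := measurable_burgersProfile a b ε
      have h2 := hφ.smooth.continuous.measurable
      fun_prop
    refine hm.aestronglyMeasurable.congr ?_
    filter_upwards [ae_restrict_mem measurableSet_quarterPlane] with p hp
    rw [heq ε hε p hp]
  · filter_upwards [self_mem_nhdsWithin] with ε hε
    filter_upwards [ae_restrict_mem measurableSet_quarterPlane] with p hp
    have hx : 0 < p.1 := hp.1
    have ht : 0 < p.2 := hp.2
    have hε' : 0 < ε := hε
    rw [heq ε hε p hp, norm_mul, Real.norm_eq_abs, Real.norm_eq_abs]
    refine mul_le_mul_of_nonneg_right ?_ (abs_nonneg _)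
    refine (abs_add_le _ _).trans (add_le_add_left ?_ _)
    rw [abs_mul]
    refine mul_le_mul_of_nonneg_left ?_ (abs_nonneg _)
    refine (abs_add_le _ _).trans (add_le_add_left ?_ _)
    exact abs_burgersProfile_le hx.le (inv_pos.2 (Real.sqrt_pos.2 (by positivity))) a b p.2
  · filter_upwards [ae_tendsto_viscousU hw k j] with p hp
    exact ((hp.const_mul α).add_const c).mul_const (φ p)

theorem isWeakSolutionOnLevelSet_limitSpeed (k : ℝ) (j : ℕ) (c a b : ℝ) :
    IsWeakSolutionOnLevelSet k j c (fun x t => limitSpeed a b x t + signedSpeed k j)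
      (fun x t => signedSpeed k j * (limitSpeed a b x t + signedSpeed k j) + c) := by
  set α := signedSpeed k j with hα
  have hm := measurable_limitSpeed a b
  -- For `u = U + α` and `σ = α u + c` the terms linear in `U` cancel in both fluxes: `u²/2 - σ =
  -- U²/2 - α²/2 - c` and `α u²/2 - k² u = α U²/2 - α³/2`. Each equation is thus a multiple of
  -- Burgers' equation plus constants, which integrate to zero against derivatives of test
  -- functions.
  have hweak : ∀ A B D : ℝ, ∀ φ : ℝ × ℝ → ℝ, IsTestFunction φ →
      ∫ p in quarterPlane, (A * (limitSpeed a b p.1 p.2 * fderiv ℝ φ p (0, 1)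
        + limitSpeed a b p.1 p.2 ^ 2 / 2 * fderiv ℝ φ p (1, 0))
        + (B * fderiv ℝ φ p (0, 1) + D * fderiv ℝ φ p (1, 0))) = 0 := by
    intro A B D φ hφ
    have hi : ∀ v, Integrable (fun p => fderiv ℝ φ p v) (volume.restrict quarterPlane) := fun v =>
      ((hφ.contDiff_fderiv_apply v).continuous.integrable_of_hasCompactSupport
        (hφ.hasCompactSupport_fderiv_apply v)).restrict
    have h1 := integrableOn_mul_of_bounded hm.aestronglyMeasurable
      (fun p _ => abs_limitSpeed_le a b p.1 p.2)
      (hφ.contDiff_fderiv_apply (0, 1)).continuous (hφ.hasCompactSupport_fderiv_apply (0, 1))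
    have h2 := integrableOn_mul_of_bounded (f := fun p => limitSpeed a b p.1 p.2 ^ 2 / 2)
      (C := (|a| + |b|) ^ 2 / 2) (by fun_prop) (fun p _ => by
        have := abs_le.1 (abs_limitSpeed_le a b p.1 p.2)
        rw [abs_of_nonneg (by positivity)]
        have := sq_le_sq' this.1 this.2
        linarith)
      (hφ.contDiff_fderiv_apply (1, 0)).continuous (hφ.hasCompactSupport_fderiv_apply (1, 0))
    rw [integral_add ((h1.fun_add h2).const_mul A)
        (((hi (0, 1)).const_mul B).fun_add ((hi (1, 0)).const_mul D)),
      integral_add ((hi (0, 1)).const_mul B) ((hi (1, 0)).const_mul D), integral_const_mul,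
      integral_const_mul, integral_const_mul, burgers_weak_limitSpeed a b hφ,
      hφ.setIntegral_fderiv_eq_zero, hφ.setIntegral_fderiv_eq_zero]
    simp
  refine ⟨?_, ?_, ?_, ?_⟩
  · refine memLp_top_of_bound (C := |a| + |b| + |α|) (by fun_prop) (ae_of_all _ fun p => ?_)
    exact (abs_add_le _ _).trans (add_le_add_left (abs_limitSpeed_le a b p.1 p.2) _)
  · refine ae_of_all _ fun p => ?_
    simp only [signedSpeed_eq]
    ring
  · intro φ hφ
    refine Eq.trans ?_ (hweak 1 α (-(α ^ 2 / 2) - c) φ hφ)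
    congr 1
    ext p
    ring
  · intro φ hφ
    refine Eq.trans ?_ (hweak α (α ^ 2 + c) (-(α ^ 3 / 2)) φ hφ)
    congr 1
    ext p
    rw [← signedSpeed_sq k j, ← hα]
    ring

theorem theorem4p1
    (k : ℝ) (hk : 0 < k) (j : ℕ) (hj : j = 1 ∨ j = 2)
    (c u₀ σ₀ u_b σ_b : ℝ)
    (h₀ : σ₀ + (-1) ^ j * k * u₀ = c) (h_b : σ_b + (-1) ^ j * k * u_b = c)
    (v₀ v_b : ℝ) (hv₀ : v₀ = u₀ - signedSpeed k j) (hv_b : v_b = u_b - signedSpeed k j) :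
    -- the approximations exist for every viscosity
    (∀ ε > 0, ∃ w : ℝ → ℝ → ℝ, IsHopfColeSolution ε v₀ v_b w) ∧
    ∃ u σ : ℝ → ℝ → ℝ,
      -- convergence of the approximations, which are well defined since `w > 0`
      (∀ w : ℝ → ℝ → ℝ → ℝ, (∀ ε > 0, IsHopfColeSolution ε v₀ v_b (w ε)) →
        (∀ ε > 0, ∀ x ≥ 0, ∀ t ≥ 0, 0 < w ε x t) ∧
        (∀ᵐ p ∂(volume.restrict quarterPlane),
          Tendsto (fun ε => viscousU k j ε (w ε) p.1 p.2) (𝓝[>] 0) (𝓝 (u p.1 p.2))) ∧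
        (∀ φ : ℝ × ℝ → ℝ, IsTestFunction φ →
          Tendsto (fun ε => ∫ p in quarterPlane, viscousSigma k j c ε (w ε) p.1 p.2 * φ p)
            (𝓝[>] 0) (𝓝 (∫ p in quarterPlane, σ p.1 p.2 * φ p)))) ∧
      -- the stress is given by the velocity
      (∀ x > 0, ∀ t > 0, σ x t = signedSpeed k j * u x t + c) ∧
      -- case 1
      (v₀ = v_b → 0 < v_b → ∀ x > 0, ∀ t > 0, u x t = u₀) ∧
      -- case 2
      (v₀ = v_b → v_b < 0 → ∀ x > 0, ∀ t > 0, u x t = u₀) ∧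
      -- case 3
      (0 < v_b → v_b < v₀ → ∀ x > 0, ∀ t > 0,
        (x < v_b * t → u x t = u_b) ∧
        (v_b * t < x → x < v₀ * t → u x t = x / t + signedSpeed k j) ∧
        (v₀ * t < x → u x t = u₀)) ∧
      -- case 4
      (v_b < 0 → 0 < v₀ → ∀ x > 0, ∀ t > 0,
        (x < v₀ * t → u x t = x / t + signedSpeed k j) ∧
        (v₀ * t < x → u x t = u₀)) ∧
      -- case 5
      (v_b < 0 → v₀ ≤ 0 → ∀ x > 0, ∀ t > 0, u x t = u₀) ∧
      -- case 6
      (v₀ < v_b → 0 < v_b + v₀ → ∀ x > 0, ∀ t > 0,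
        (x < (v₀ + v_b) / 2 * t → u x t = u_b) ∧
        ((v₀ + v_b) / 2 * t < x → u x t = u₀)) ∧
      -- the limit solves the system and takes the initial values
      IsWeakSolutionOnLevelSet k j c u σ ∧
      (∀ x > 0, Tendsto (fun t => u x t) (𝓝[>] 0) (𝓝 u₀) ∧
        Tendsto (fun t => σ x t) (𝓝[>] 0) (𝓝 σ₀)) := by
  have hα : ∀ x t, limitSpeed v₀ v_b x t = v₀ → limitSpeed v₀ v_b x t + signedSpeed k j = u₀ :=
    fun x t h => by rw [h, hv₀]; ring
  have hβ : ∀ x t, limitSpeed v₀ v_b x t = v_b → limitSpeed v₀ v_b x t + signedSpeed k j = u_b :=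
    fun x t h => by rw [h, hv_b]; ring
  have hraref : v_b ≤ v₀ → ∀ x t, limitSpeed v₀ v_b x t = max v_b (min v₀ (x / t)) :=
    fun h x t => if_neg (not_lt.2 h)
  have hshock : v₀ < v_b → ∀ x t, limitSpeed v₀ v_b x t
      = if x < (v₀ + v_b) / 2 * t then v_b else v₀ := fun h x t => if_pos h
  have hright : v_b ≤ v₀ → ∀ x t, 0 < t → v₀ * t ≤ x → limitSpeed v₀ v_b x t = v₀ :=
    fun h x t ht hx => by
      rw [hraref h, min_eq_left ((le_div_iff₀ ht).2 hx), max_eq_right h]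
  have hfan : v_b ≤ v₀ → ∀ x t, 0 < t → v_b * t ≤ x → x ≤ v₀ * t →
      limitSpeed v₀ v_b x t = x / t := fun h x t ht hx hx' => by
    rw [hraref h, min_eq_right ((div_le_iff₀ ht).2 hx'), max_eq_right ((le_div_iff₀ ht).2 hx)]
  have hconst : v₀ = v_b → ∀ x t, limitSpeed v₀ v_b x t = v₀ := fun h x t => by
    obtain ⟨h1, h2⟩ := limitSpeed_mem_Icc h.ge x t
    exact le_antisymm h2 (h.trans_le h1)
  refine ⟨fun ε hε => ?_, fun x t => limitSpeed v₀ v_b x t + signedSpeed k j,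
    fun x t => signedSpeed k j * (limitSpeed v₀ v_b x t + signedSpeed k j) + c,
    fun w hw => ⟨fun ε hε x hx t ht => (hw ε hε).pos hε hx ht, ae_tendsto_viscousU hw k j,
      fun φ hφ => tendsto_integral_viscousSigma hw k j c hφ⟩,
    fun _ _ _ _ => rfl, fun h _ x _ t _ => hα x t (hconst h x t),
    fun h _ x _ t _ => hα x t (hconst h x t), ?_, ?_, ?_, ?_,
    isWeakSolutionOnLevelSet_limitSpeed k j c v₀ v_b, ?_⟩
  · have h := isHopfColeSolution_robinSolution hε (v_b / (2 * ε)) (v₀ / (2 * ε))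
    rw [mul_div_cancel₀ v₀ (by positivity), mul_div_cancel₀ v_b (by positivity)] at h
    exact ⟨_, h⟩
  · intro _ h x _ t ht
    refine ⟨fun h1 => hβ x t ?_, fun h1 h2 => ?_, fun h1 => hα x t (hright h.le x t ht h1.le)⟩
    · rw [hraref h.le]
      exact max_eq_left ((min_le_right _ _).trans ((div_le_iff₀ ht).2 h1.le))
    · simp only
      rw [hfan h.le x t ht h1.le h2.le]
  · intro hb h0 x hx t ht
    have h : v_b ≤ v₀ := by linarith
    refine ⟨fun h1 => ?_, fun h1 => hα x t (hright h x t ht h1.le)⟩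
    simp only
    rw [hfan h x t ht (by nlinarith) h1.le]
  · intro hb h0 x hx t ht
    refine hα x t ?_
    -- Both data are nonpositive, so neither the shock ray nor the fan enters the open quarter
    -- plane.
    rcases lt_or_ge v₀ v_b with h | h
    · rw [hshock h, if_neg]
      nlinarith
    · exact hright h x t ht (by nlinarith)
  · intro h _ x _ t _
    refine ⟨fun h1 => hβ x t ?_, fun h1 => hα x t ?_⟩
    · rw [hshock h, if_pos h1]
    · rw [hshock h, if_neg (not_lt.2 h1.le)]
  · intro x hx
    have h1 := (tendsto_limitSpeed_initial v₀ v_b hx).add_const (signedSpeed k j)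
    have h2 := (h1.const_mul (signedSpeed k j)).add_const c
    have e1 : v₀ + signedSpeed k j = u₀ := by rw [hv₀]; ring
    have e2 : signedSpeed k j * u₀ + c = σ₀ := by
      rw [signedSpeed_eq] at h₀
      linarith
    rw [e1] at h1 h2
    rw [e2] at h2
    exact ⟨h1, h2⟩
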